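/- **Setting.** Let $0\le m\le n-1$, $d=n-m-1$, and write $\xi=(\xi_1,\xi',\xi'')\in\mathbb R\times\mathbb R^{d}\times\mathbb R^{m}=\mathbb R^n$, and similarly for $\mathbb Z^n$. Put $e(z)=e^{2\pi i z}$, $\widehat f(\xi)=\int f(x)\,e(-x\cdot\xi)\,dx$, let $B(a,r)$ denote closed balls, and let $e^{it\Delta}$ be the unitary group on $L^2(\mathbb R^n)$ with Fourier multiplier $e(t|\xi|^2)$, so that $e^{it\Delta}f(x)=\int\widehat f(\xi)\,e(x\cdot\xi+t|\xi|^2)\,d\xi$ when $\widehat f$ is integrable. Let $c>0$, and let $\phi\in\mathcal S(\mathbb R)$, $\varphi_1\in\mathcal S(\mathbb R^{d})$, $\varphi_2\in\mathcal S(\mathbb R^m)$ have Fourier transforms that are nonnegative, not identically zero and supported in $B(0,c)$; let $\psi\in\mathcal S(\mathbb R^{d})$ be nonnegative, not identically zero and supported in $B(0,c)$. For $R,D_1,D_2\ge 1$ let $f_R(x)=g(x_1)h_1(x')h_2(x'')$, where $$\widehat g(\xi_1)=\widehat\phi\Big(\frac{\xi_1-R}{R^{1/2}}\Big),\qquad \widehat{h_1}(\xi')=\sum_{\ell'\in\mathbb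 Z^{d}}\psi\Big(\frac{\ell'}{R/D_1}\Big)\widehat\varphi_1(\xi'-D_1\ell'),\qquad \widehat{h_2}(\xi'')=\sum_{\ell''\in\mathbb Z^m,\ |\ell''|\le cR^{1/2}/D_2}\widehat\varphi_2(\xi''-D_2\ell'').$$ Let $Q=R^{a}$, $D_1=R^{b}$, $D_2=R^{\gamma}$ with $a,b\ge0$, $0\le\gamma\le\frac12$ and, if $d\ge1$, $a+b<1$. Define $s_m$ by $$R^{s_m}=R^{1/4}\Big(\frac{R}{D_1Q}\Big)^{d/2}\Big(\frac{R^{1/2}}{D_2}\Big)^{m/2}.$$ For $p=(p_1,p',p'')\in\mathbb Z^n$ and $q\in\mathbb N$ let $$E_R(p,q)=B^1\Big(-\frac{2R}{D_1^2}\frac{p_1}{q},\frac1{R^{1/2}}\Big)\times B^{d}\Big(\frac{p'}{D_1q},\frac1R\Big)\times B^m\Big(\frac{p''}{D_2},\frac1{R^{1/2}}\Big).$$ Let $R_k=2^k$ and let $Q_k=R_k^a$; let $F_k$ be the union of the slabs $E_{R_k}(p,q)$ over all odd $q$ with $Q_k/2\le q<Q_k$ and all $p\in\mathbb Z^n$ with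 $\gcd(p_1,q)=1$. For $K_0\in\mathbb N$ put $$f=\sum_{j\ge K_0} j\,\frac{f_{R_j}}{R_j^{s_m}\,\|f_{R_j}\|_2}.$$ **Theorem.** If $c$ is smaller than a constant depending only on $n,m$, then there are a constant $C>0$ and an integer $K$, depending only on $n,m$, the profiles $\phi,\varphi_1,\varphi_2,\psi$, on $c$ and on the exponents $a,b,\gamma$, such that for every $K_0\ge K$: 1. The series defining $f$ converges for almost every $x$, and $f\in L^2(\mathbb R^n)$ lies in $H^s(\mathbb R^n)$ for every $s<s_m$. 2. For every $t\neq0$ the $L^2$ function $e^{it\Delta}f$ has a continuous representative, still denoted $e^{it\Delta}f(x)$, and for every $x\in\mathbb R^n$ it is given by the convergent series $\sum_{j\ge K_0} j\,e^{it\Delta}f_{R_j}(x)/(R_j^{s_m}\|f_{R_j}\|_2)$. 3. For every $k\ge K_0$ and every $x\in F_k\cap B(0,1)$ with $\frac1{10}<|x_1|\le1$ there is a time $t=t(x)$ with $C^{-1}R_k^{-1}\le|t|\le CR_k^{-1}$ and $|e^{it\Delta}f(x)|\ge C^{-1}k$. 4. For every $x\in\big(\limsup_{k\to\infty}F_k\big)\cap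 B(0,1)$ with $x_1\ne0$ (in particular whenever $\frac1{10}<|x_1|\le 1$), $\displaystyle\limsup_{t\to0,\ t\ne 0}|e^{it\Delta}f(x)|=\infty$. -/

import Mathlib

open MeasureTheory Filter Topology Metric
open scoped FourierTransform SchwartzMap ENNReal

noncomputable section

namespace Dyadic

/-- Euclidean space `ℝⁿ`. -/
abbrev Vec (n : ℕ) := EuclideanSpace ℝ (Fin n)

/-- `e(z) = exp(2πiz)`. -/
def e (z : ℝ) : ℂ := Complex.exp (2 * Real.pi * Complex.I * z)

/-! ### The splitting `ξ = (ξ₁, ξ', ξ'') ∈ ℝ × ℝᵈ × ℝᵐ` of `ℝⁿ`, where `n = d + m + 1`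

The first coordinate `ξ₁` is `ξ 0`. -/

/-- The middle block `ξ' ∈ ℝᵈ`, `d = n - m - 1`. -/
def mid {d m : ℕ} (ξ : Vec (d + m + 1)) : Vec d :=
  WithLp.toLp 2 fun i => ξ (Fin.succ (Fin.castAdd m i))

/-- The last block `ξ'' ∈ ℝᵐ`. -/
def last {d m : ℕ} (ξ : Vec (d + m + 1)) : Vec m :=
  WithLp.toLp 2 fun i => ξ (Fin.succ (Fin.natAdd d i))

/-- An integer vector as a point of Euclidean space. -/
def lattice {n : ℕ} (l : Fin n → ℤ) : Vec n :=
  WithLp.toLp 2 fun i => (l i : ℝ)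

/-! ### The Schrödinger evolution -/

lemma norm_e (z : ℝ) : ‖e z‖ = 1 := by
  have h : (2 * Real.pi * Complex.I * z : ℂ) = ((2 * Real.pi * z : ℝ) : ℂ) * Complex.I := by
    push_cast; ring
  rw [e, h, Complex.norm_exp_ofReal_mul_I]

lemma memLp_e_mul {n : ℕ} (t : ℝ) (f : Lp ℂ 2 (volume : Measure (Vec n))) :
    MemLp (fun ξ : Vec n => e (t * ‖ξ‖ ^ 2) * f ξ) 2 volume := by
  have hc : Continuous fun ξ : Vec n => e (t * ‖ξ‖ ^ 2) := by
    unfold e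
    fun_prop
  refine (Lp.memLp f).of_le (hc.aestronglyMeasurable.mul (Lp.aestronglyMeasurable f)) ?_
  filter_upwards with ξ
  simp [norm_e]

/-- The Schrödinger group on `L²(ℝⁿ)`: multiplication of the Fourier transform by `e(t|ξ|²)`. -/
def schrodinger {n : ℕ} (t : ℝ) (f : Lp ℂ 2 (volume : Measure (Vec n))) :
    Lp ℂ 2 (volume : Measure (Vec n)) :=
  𝓕⁻ ((memLp_e_mul t (𝓕 f)).toLp _)

/-- `u t x` gives the pointwise values of `e^{itΔ}f` for `t ≠ 0`: the function `u t` is the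
(necessarily unique) continuous representative of the `L²` class `e^{itΔ}f`. -/
def IsPointwiseEvolution {n : ℕ} (f : Lp ℂ 2 (volume : Measure (Vec n)))
    (u : ℝ → Vec n → ℂ) : Prop :=
  ∀ t : ℝ, t ≠ 0 → Continuous (u t) ∧ u t =ᵐ[volume] schrodinger t f

/-! ### The datum at one scale -/

/-- The profiles `φ`, `φ₁`, `φ₂`, `ψ` and the size `c` of the supports. -/
structure Profile (d m : ℕ) where
  c : ℝ
  φ : 𝓢(ℝ, ℂ)
  φ₁ : 𝓢(Vec d, ℂ)
  φ₂ : 𝓢(Vec m, ℂ)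
  ψ : 𝓢(Vec d, ℝ)

/-- `χ` is real, nonnegative, not identically zero, and supported in `B(0,c)`. -/
def IsBump {V : Type*} [NormedAddCommGroup V] (χ : V → ℂ) (c : ℝ) : Prop :=
  (∀ ξ, (χ ξ).im = 0 ∧ 0 ≤ (χ ξ).re) ∧ (∃ ξ, χ ξ ≠ 0) ∧
    Function.support χ ⊆ closedBall 0 c

/-- The Fourier transforms of `φ`, `φ₁`, `φ₂`, and `ψ` itself, are bumps supported in `B(0,c)`. -/
def Profile.Admissible {d m : ℕ} (P : Profile d m) : Prop :=
  0 < P.c ∧ IsBump (fun ξ => (𝓕 P.φ) ξ) P.c ∧ IsBump (fun ξ => (𝓕 P.φ₁) ξ) P.c ∧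
    IsBump (fun ξ => (𝓕 P.φ₂) ξ) P.c ∧ IsBump (fun y => (P.ψ y : ℂ)) P.c

/-- `ĝ(ξ₁)`. -/
def gHat {d m : ℕ} (P : Profile d m) (R : ℝ) (ξ : ℝ) : ℂ :=
  (𝓕 P.φ) ((ξ - R) / √R)

/-- `ĥ₁(ξ')`. The sum has finitely many nonzero terms. -/
def h₁Hat {d m : ℕ} (P : Profile d m) (R D₁ : ℝ) (ξ : Vec d) : ℂ :=
  ∑' l : Fin d → ℤ, (P.ψ ((R / D₁)⁻¹ • lattice l) : ℂ) * (𝓕 P.φ₁) (ξ - D₁ • lattice l)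

/-- `ĥ₂(ξ'')`. The sum is over the finite set `|ℓ''| ≤ c R^{1/2} / D₂`. -/
def h₂Hat {d m : ℕ} (P : Profile d m) (R D₂ : ℝ) (ξ : Vec m) : ℂ :=
  ∑' l : {l : Fin m → ℤ // ‖lattice l‖ ≤ P.c * √R / D₂}, (𝓕 P.φ₂) (ξ - D₂ • lattice l.1)

/-- The Fourier transform of `f_R(x) = g(x₁) h₁(x') h₂(x'')`. -/
def pieceHat {d m : ℕ} (P : Profile d m) (R D₁ D₂ : ℝ) (ξ : Vec (d + m + 1)) : ℂ :=
  gHat P R (ξ 0) * h₁Hat P R D₁ (mid ξ) * h₂Hat P R D₂ (last ξ)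

/-- The datum `f_R`. -/
def piece {d m : ℕ} (P : Profile d m) (R D₁ D₂ : ℝ) : Vec (d + m + 1) → ℂ :=
  𝓕⁻ (pieceHat P R D₁ D₂)

/-- `e^{itΔ}f_R(x) = ∫ f̂_R(ξ) e(x·ξ + t|ξ|²) dξ`. -/
def pieceEvol {d m : ℕ} (P : Profile d m) (R D₁ D₂ t : ℝ) (x : Vec (d + m + 1)) : ℂ :=
  ∫ ξ, pieceHat P R D₁ D₂ ξ * e (inner ℝ x ξ + t * ‖ξ‖ ^ 2)

/-- `‖f_R‖₂`. -/
def pieceNorm {d m : ℕ} (P : Profile d m) (R D₁ D₂ : ℝ) : ℝ :=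
  (eLpNorm (piece P R D₁ D₂) 2 volume).toReal

/-! ### The dyadic sum -/

/-- The exponents in `Q = R^a`, `D₁ = R^b`, `D₂ = R^γ`. -/
structure Exponents where
  a : ℝ
  b : ℝ
  γ : ℝ

/-- `Q, D₁, D₂ ≥ 1` and `D₂ ≤ R^{1/2}`; and, if the block `x' ∈ ℝᵈ` is present, `D₁ Q` is
a power of `R` smaller than `R`. -/
def Exponents.Admissible (d : ℕ) (X : Exponents) : Prop :=
  0 ≤ X.a ∧ 0 ≤ X.b ∧ 0 ≤ X.γ ∧ X.γ ≤ 1 / 2 ∧ (d = 0 ∨ X.a + X.b < 1)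

/-- The exponent `s_m` in `R^{s_m} = R^{1/4} (R / (D₁ Q))^{d/2} (R^{1/2} / D₂)^{m/2}`. -/
def Exponents.reg (d m : ℕ) (X : Exponents) : ℝ :=
  1 / 4 + (1 - X.a - X.b) * (d / 2) + (1 / 2 - X.γ) * (m / 2)

/-- `R_j = 2^j`. -/
def scale (j : ℕ) : ℝ := 2 ^ j

/-- The coefficient `j / (R_j^{s_m} ‖f_{R_j}‖₂)`. -/
def coeff {d m : ℕ} (P : Profile d m) (X : Exponents) (j : ℕ) : ℝ :=
  j / (scale j ^ X.reg d m * pieceNorm P (scale j) (scale j ^ X.b) (scale j ^ X.γ))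

/-- The `j`-th term `j f_{R_j} / (R_j^{s_m} ‖f_{R_j}‖₂)`. -/
def term {d m : ℕ} (P : Profile d m) (X : Exponents) (j : ℕ) (x : Vec (d + m + 1)) : ℂ :=
  coeff P X j * piece P (scale j) (scale j ^ X.b) (scale j ^ X.γ) x

/-- The evolution of the `j`-th term. -/
def termEvol {d m : ℕ} (P : Profile d m) (X : Exponents) (j : ℕ) (t : ℝ)
    (x : Vec (d + m + 1)) : ℂ :=
  coeff P X j * pieceEvol P (scale j) (scale j ^ X.b) (scale j ^ X.γ) t x

/-- The datum `f = ∑_{j ≥ K₀} j f_{R_j} / (R_j^{s_m} ‖f_{R_j}‖₂)`. -/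
def datum {d m : ℕ} (P : Profile d m) (X : Exponents) (K₀ : ℕ) (x : Vec (d + m + 1)) : ℂ :=
  ∑' j : Set.Ici K₀, term P X j x

/-! ### The divergence set -/

/-- The slab `E_R(p,q)`. At the time `t = p₁ / (D₁² q)` its centre satisfies `x₁ + 2Rt = 0`. -/
def slab {d m : ℕ} (R D₁ D₂ : ℝ) (p : Fin (d + m + 1) → ℤ) (q : ℕ) : Set (Vec (d + m + 1)) :=
  {x | |x 0 - (-(2 * R / D₁ ^ 2 * (p 0 / q)))| ≤ 1 / √R ∧
    ‖mid x - (1 / (D₁ * q)) • mid (lattice p)‖ ≤ 1 / R ∧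
    ‖last x - (1 / D₂) • last (lattice p)‖ ≤ 1 / √R}

/-- `F_k`, the union of the slabs `E_{R_k}(p,q)` over odd `q` with `Q_k/2 ≤ q < Q_k` and over
`p ∈ ℤⁿ` with `gcd(p₁, q) = 1`. -/
def slabUnion (d m : ℕ) (X : Exponents) (k : ℕ) : Set (Vec (d + m + 1)) :=
  {x | ∃ q : ℕ, Odd q ∧ scale k ^ X.a / 2 ≤ q ∧ (q : ℝ) < scale k ^ X.a ∧
    ∃ p : Fin (d + m + 1) → ℤ, Int.gcd (p 0) q = 1 ∧
      x ∈ slab (scale k) (scale k ^ X.b) (scale k ^ X.γ) p q}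

end Dyadic

end

/-!
# Divergence of the Schrödinger evolution of a dyadic sum of tensor products

The Fourier transform of `f_R` is a tensor product, so its evolution factors over the three blocks
of variables (`pieceEvol_eq_mul`), and each factor can be read off the sum of translated bumps that
defines it.

*Where the evolution is large.* Let `t = p₁ / (D₁² q)`, and let `x` lie in the slab `E_R(p,q)`. The
first coordinate then satisfies `|x₁ + 2tR| ≤ R^{-1/2}`, which together with `|x| ≤ 1` gives
`|t| R ≤ 1`. For `c ≤ 1/100` the phases in the `g` and `h₂` factors are, modulo `1`, within `1/12`
of a constant, so nonnegative amplitudes cannot cancel: the factors have sizes `R^{1/2}` and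
`(R^{1/2} / D₂)^m` (`le_norm_integral_gHat`, `le_norm_integral_h₂Hat`). The `h₁` factor is a theta
sum with coefficients `e((p₁|ℓ'|² + p'·ℓ') / q)`. Poisson summation along residue classes mod `q`
(`hasSum_fourier_lattice`, `norm_tsum_theta_sub_le`) replaces it by Gauss sums times values of `ψ̂`
on the dual lattice. The Gauss sums all have modulus `q^{d/2}`, since `q` is odd and prime to `p₁`.
The dual lattice has spacing `R / (q D₁)`, which tends to infinity because `a + b < 1`, so the
frequency `0` dominates and the factor has size `(R / (D₁ q^{1/2}))^d`
(`exists_le_norm_integral_h₁Hat`). As `q < Q`, the product of the three sizes is at least a constant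
times `R^{s_m} ‖f_R‖₂` (`exists_rpow_reg_mul_pieceNorm_le`), so the `k`-th term of the evolved
series is at least a constant times `k` there (`exists_le_norm_termEvol`).

*Where it is small.* The `g` factor is an integral with phase
`R^{1/2} (x₁ + 2tR) η + tR η²`; integrating by parts many times shows that the evolution of `f_R` is
`O(1/R)` wherever `1 + |t|R ≤ M |x₁ + 2tR|` (`exists_norm_pieceEvol_le`). For fixed `t ≠ 0` and `x`
bounded this holds for all large `R`, so the evolved series converges locally uniformly, and it
represents the evolution of the datum because the datum converges absolutely in `L²`
(`datum_properties`). If `x₁ ≠ 0` and `x₁ + 2tR_k` is small, it also holds at every scale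
`R_j`, `j ≠ k`, because `R_j / R_k` is at most `1/2` or at least `2` (`one_add_mul_scale_le`). Hence
the other terms contribute a bounded amount, and the evolved datum has size comparable to `k` at a
time comparable to `1 / R_k` (`exists_le_norm_evolution`). A point in infinitely many of the sets
`F_k` sees this for arbitrarily large `k`, which is divergence.
-/

noncomputable section

namespace DyadicDivergence

open Dyadic (Vec e mid last lattice norm_e memLp_e_mul schrodinger IsPointwiseEvolution Profile
  IsBump gHat h₁Hat h₂Hat pieceHat piece pieceEvol pieceNorm Exponents scale coeff term termEvol
  datum slab slabUnion)

/-! ### The splitting of `ℝⁿ` into three blocks -/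

section Splitting

variable {d m : ℕ}

/-- The identification `ξ ↦ (ξ₁, ξ', ξ'')` of `ℝⁿ` with `ℝ × ℝᵈ × ℝᵐ`. -/
def splitEquiv (d m : ℕ) : Vec (d + m + 1) ≃ᵐ ℝ × Vec d × Vec m :=
  (MeasurableEquiv.toLp 2 (Fin (d + m + 1) → ℝ)).symm.trans <|
  (MeasurableEquiv.piFinSuccAbove (fun _ => ℝ) 0).trans <|
  MeasurableEquiv.prodCongr (MeasurableEquiv.refl ℝ) <|
  (MeasurableEquiv.piCongrLeft (fun _ => ℝ) finSumFinEquiv).symm.trans <|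
  (MeasurableEquiv.sumPiEquivProdPi (fun _ : Fin d ⊕ Fin m => ℝ)).trans <|
  MeasurableEquiv.prodCongr (MeasurableEquiv.toLp 2 _) (MeasurableEquiv.toLp 2 _)

lemma splitEquiv_apply (ξ : Vec (d + m + 1)) :
    splitEquiv d m ξ = (ξ 0, mid ξ, last ξ) := by
  refine Prod.ext rfl (Prod.ext ?_ ?_)
  · ext i
    rfl
  · ext i
    rfl

lemma measurePreserving_splitEquiv : MeasurePreserving (splitEquiv d m) := by
  refine (EuclideanSpace.volume_preserving_symm_measurableEquiv_toLp _).trans ?_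
  refine (volume_preserving_piFinSuccAbove (fun _ => ℝ) 0).trans ?_
  refine (MeasurePreserving.id volume).prod ?_
  refine (volume_measurePreserving_piCongrLeft (fun _ => ℝ) finSumFinEquiv).symm.trans ?_
  refine (volume_measurePreserving_sumPiEquivProdPi (fun _ : Fin d ⊕ Fin m => ℝ)).trans ?_
  exact ((EuclideanSpace.volume_preserving_symm_measurableEquiv_toLp _).symm).prod
    ((EuclideanSpace.volume_preserving_symm_measurableEquiv_toLp _).symm)

lemma integral_split_mul {L : Type*} [RCLike L] (f : ℝ → L) (g : Vec d → L) (h : Vec m → L) :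
    ∫ ξ : Vec (d + m + 1), f (ξ 0) * g (mid ξ) * h (last ξ) =
      (∫ x, f x) * (∫ y, g y) * ∫ z, h z := by
  have := (measurePreserving_splitEquiv (d := d) (m := m)).integral_comp'
    (fun p : ℝ × Vec d × Vec m => f p.1 * (g p.2.1 * h p.2.2))
  simp only [splitEquiv_apply] at this
  simp only [mul_assoc]
  rw [this]
  erw [integral_prod_mul f (fun p : Vec d × Vec m => g p.1 * h p.2), integral_prod_mul g h]

lemma inner_split (x ξ : Vec (d + m + 1)) :
    inner ℝ x ξ = x 0 * ξ 0 + inner ℝ (mid x) (mid ξ) + inner ℝ (last x) (last ξ) := by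
  simp only [PiLp.inner_apply, mid, last, Fin.sum_univ_succ (n := d + m), Fin.sum_univ_add,
    RCLike.inner_apply, conj_trivial]
  ring

lemma norm_sq_split (ξ : Vec (d + m + 1)) :
    ‖ξ‖ ^ 2 = ξ 0 ^ 2 + ‖mid ξ‖ ^ 2 + ‖last ξ‖ ^ 2 := by
  rw [← real_inner_self_eq_norm_sq, inner_split, real_inner_self_eq_norm_sq,
    real_inner_self_eq_norm_sq]
  ring

lemma contDiff_mid : ContDiff ℝ (⊤ : ℕ∞) (mid : Vec (d + m + 1) → Vec d) := by
  refine contDiff_euclidean.2 fun i => ?_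
  simp only [mid]
  fun_prop

lemma contDiff_last : ContDiff ℝ (⊤ : ℕ∞) (last : Vec (d + m + 1) → Vec m) := by
  refine contDiff_euclidean.2 fun i => ?_
  simp only [last]
  fun_prop

lemma lattice_add {n : ℕ} (k l : Fin n → ℤ) : lattice (k + l) = lattice k + lattice l := by
  ext i; simp [lattice]

lemma lattice_sub {n : ℕ} (k l : Fin n → ℤ) : lattice (k - l) = lattice k - lattice l := by
  ext i; simp [lattice]

@[simp] lemma lattice_zero {n : ℕ} : lattice (0 : Fin n → ℤ) = 0 := by
  ext i; simp [lattice]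

lemma inner_lattice {n : ℕ} (k l : Fin n → ℤ) :
    inner ℝ (lattice k) (lattice l) = ((∑ i, k i * l i : ℤ) : ℝ) := by
  simp [lattice, PiLp.inner_apply, mul_comm]

lemma norm_sq_lattice {n : ℕ} (l : Fin n → ℤ) : ‖lattice l‖ ^ 2 = ((∑ i, l i ^ 2 : ℤ) : ℝ) := by
  rw [← real_inner_self_eq_norm_sq, inner_lattice]
  simp [sq]

lemma abs_apply_le_norm_lattice {n : ℕ} (l : Fin n → ℤ) (i : Fin n) :
    |(l i : ℝ)| ≤ ‖lattice l‖ := by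
  simpa [lattice] using PiLp.norm_apply_le (lattice l) i

lemma one_le_norm_lattice {n : ℕ} {l : Fin n → ℤ} (hl : l ≠ 0) : 1 ≤ ‖lattice l‖ := by
  obtain ⟨i, hi⟩ := Function.ne_iff.1 hl
  refine le_trans ?_ (abs_apply_le_norm_lattice l i)
  exact_mod_cast Int.one_le_abs hi

end Splitting

/-! ### Phases and oscillatory integrals -/

lemma e_add (x y : ℝ) : e (x + y) = e x * e y := by
  rw [e, e, e, ← Complex.exp_add]; push_cast; ring_nf

lemma e_intCast (k : ℤ) : e k = 1 := by
  rw [e, Complex.exp_eq_one_iff]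
  exact ⟨k, by push_cast; ring⟩

lemma e_add_intCast (x : ℝ) (k : ℤ) : e (x + k) = e x := by rw [e_add, e_intCast, mul_one]

lemma e_sum {ι : Type*} (s : Finset ι) (x : ι → ℝ) : e (∑ i ∈ s, x i) = ∏ i ∈ s, e (x i) := by
  classical
  induction s using Finset.induction_on with
  | empty => simp [e]
  | insert i s hi ih => rw [Finset.sum_insert hi, Finset.prod_insert hi, e_add, ih]

lemma contDiff_e : ContDiff ℝ (⊤ : ℕ∞) e := by
  have h : ContDiff ℝ (⊤ : ℕ∞) fun z : ℝ => (z : ℂ) := Complex.ofRealCLM.contDiff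
  exact Complex.contDiff_exp.comp (contDiff_const.mul h)

@[fun_prop] lemma continuous_e : Continuous e := contDiff_e.continuous

lemma hasDerivAt_e (x : ℝ) : HasDerivAt e (2 * Real.pi * Complex.I * e x) x := by
  have h := ((hasDerivAt_id x).ofReal_comp.const_mul (2 * Real.pi * Complex.I)).cexp
  refine HasDerivAt.congr_deriv (f := e) h ?_
  simp only [e, id, Complex.ofReal_one]
  ring

lemma one_half_le_re_e {θ : ℝ} (hθ : |θ| ≤ 1 / 12) : 1 / 2 ≤ (e θ).re := by
  have h : (2 * Real.pi * Complex.I * θ : ℂ) = ((2 * Real.pi * θ : ℝ) : ℂ) * Complex.I := by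
    push_cast; ring
  rw [e, h, Complex.exp_ofReal_mul_I_re, ← Real.cos_abs, ← Real.cos_pi_div_three]
  have hpi := Real.pi_pos
  apply Real.cos_le_cos_of_nonneg_of_le_pi (abs_nonneg _) (by linarith)
  rw [abs_mul, abs_of_pos (by positivity)]
  nlinarith

lemma mul_integral_le_re_integral_mul {α : Type*} [MeasurableSpace α] {μ : Measure α} {w T : α → ℂ}
    {B : ℝ} (hw : Integrable w μ) (hwT : Integrable (fun x => w x * T x) μ)
    (h0 : ∀ x, (w x).im = 0 ∧ 0 ≤ (w x).re) (hT : ∀ x, w x ≠ 0 → B ≤ (T x).re) :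
    B * ∫ x, (w x).re ∂μ ≤ (∫ x, w x * T x ∂μ).re := by
  have h1 : (∫ x, w x * T x ∂μ).re = ∫ x, (w x * T x).re ∂μ := (integral_re hwT).symm
  rw [h1, ← integral_const_mul]
  refine integral_mono (hw.re.const_mul _) hwT.re fun x => ?_
  by_cases hx : w x = 0
  · simp [hx]
  · have := hT x hx
    simp only [Complex.mul_re, (h0 x).1, zero_mul, sub_zero]
    nlinarith [(h0 x).2]

/-- Nonnegative weights carried by phases that stay within `1 / 12` of `0` cannot cancel. -/
lemma half_integral_le_re {α : Type*} [MeasurableSpace α] {μ : Measure α} {w : α → ℂ}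
    {θ : α → ℝ} (hw : Integrable w μ) (hwe : Integrable (fun x => w x * e (θ x)) μ)
    (h0 : ∀ x, (w x).im = 0 ∧ 0 ≤ (w x).re) (hθ : ∀ x, w x ≠ 0 → |θ x| ≤ 1 / 12) :
    1 / 2 * ∫ x, (w x).re ∂μ ≤ (∫ x, w x * e (θ x) ∂μ).re :=
  mul_integral_le_re_integral_mul hw hwe h0 fun x hx => one_half_le_re_e (hθ x hx)

/-- Decay of the oscillatory integral with phase `Aη + Bη²`: each power of `(1 + |B|) / |A|`
is gained by one integration by parts, for all Schwartz amplitudes at once. -/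
lemma exists_norm_integral_quadratic_phase_le (N : ℕ) (a : 𝓢(ℝ, ℂ)) :
    ∃ C : ℝ, 0 ≤ C ∧ ∀ A B : ℝ, A ≠ 0 →
      ‖∫ η, a η * e (A * η + B * η ^ 2)‖ ≤ C * ((1 + |B|) / |A|) ^ N := by
  induction N generalizing a with
  | zero =>
    refine ⟨∫ η, ‖a η‖, integral_nonneg fun _ => norm_nonneg _, fun A B _ => ?_⟩
    rw [pow_zero, mul_one]
    refine (norm_integral_le_integral_norm _).trans_eq ?_
    simp [norm_e]
  | succ N ih =>
    have hid : (fun x : ℝ => (x : ℂ)).HasTemperateGrowth := by fun_prop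
    set b : 𝓢(ℝ, ℂ) := SchwartzMap.smulLeftCLM ℂ (fun x : ℝ => (x : ℂ)) a with hb
    have hb' : ∀ x, b x = x * a x := fun x => by
      rw [hb, SchwartzMap.smulLeftCLM_apply_apply hid, smul_eq_mul]
    obtain ⟨C₁, hC₁, h₁⟩ := ih (SchwartzMap.derivCLM ℝ ℂ a)
    obtain ⟨C₂, hC₂, h₂⟩ := ih b
    refine ⟨C₁ + 2 * C₂, by positivity, fun A B hA => ?_⟩
    have hpi := Real.pi_pos
    set F : ℝ → ℂ := fun η => a η * e (A * η + B * η ^ 2) with hF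
    set G : ℝ → ℂ := fun η => (SchwartzMap.derivCLM ℝ ℂ a) η * e (A * η + B * η ^ 2) with hG
    set H : ℝ → ℂ := fun η => b η * e (A * η + B * η ^ 2) with hH
    have hint : ∀ c : 𝓢(ℝ, ℂ), Integrable fun η => c η * e (A * η + B * η ^ 2) := fun c => by
      refine c.integrable.mono (c.continuous.mul (by fun_prop)).aestronglyMeasurable ?_
      filter_upwards with η
      simp [norm_e]
    -- the derivative of the integrand has zero integral, which expresses `A * ∫ F` through
    -- integrals with the amplitudes `a'` and `η a`
    have hder : ∀ η, HasDerivAt F (G η + (2 * Real.pi * Complex.I * A * F η +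
        4 * Real.pi * Complex.I * B * H η)) η := fun η => by
      have h1 : HasDerivAt (fun η : ℝ => A * η + B * η ^ 2) (A + 2 * B * η) η := by
        refine (((hasDerivAt_id η).const_mul A).add
          (((hasDerivAt_id η).pow 2).const_mul B)).congr_deriv ?_
        simp only [id]
        norm_num
        ring
      have h2 := (hasDerivAt_e (A * η + B * η ^ 2)).scomp η h1
      have h3 := (a.differentiableAt (x := η)).hasDerivAt.mul h2
      refine HasDerivAt.congr_deriv (f := F) h3 ?_
      simp only [hG, hF, hH, hb', SchwartzMap.derivCLM_apply, Function.comp, Complex.real_smul]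
      push_cast
      ring
    have hzero := integral_eq_zero_of_hasDerivAt_of_integrable hder
      ((hint _).add (((hint a).const_mul _).add ((hint b).const_mul _))) (hint a)
    have hsum : (∫ η, G η) + (2 * Real.pi * Complex.I * A * (∫ η, F η) +
        4 * Real.pi * Complex.I * B * ∫ η, H η) = 0 := by
      have hF' : Integrable F := hint a
      have hH' : Integrable H := hint b
      have hG' : Integrable G := hint _
      have hK : Integrable fun x => 2 * Real.pi * Complex.I * A * F x +
          4 * Real.pi * Complex.I * B * H x := (hF'.const_mul _).add (hH'.const_mul _)
      rw [← hzero, integral_add hG' hK, integral_add (hF'.const_mul _) (hH'.const_mul _),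
        integral_const_mul, integral_const_mul]
    have hsol : 2 * Real.pi * Complex.I * A * (∫ η, F η) =
        -((∫ η, G η) + 4 * Real.pi * Complex.I * B * ∫ η, H η) := by
      linear_combination hsum
    have hnorm := congrArg norm hsol
    rw [norm_neg] at hnorm
    have hle := hnorm.le.trans (norm_add_le _ _)
    simp only [norm_mul, Complex.norm_real, Complex.norm_I, Real.norm_eq_abs, abs_of_pos hpi,
      Complex.norm_ofNat, mul_one] at hle
    have hA' : 0 < |A| := abs_pos.2 hA
    set r := (1 + |B|) / |A| with hr
    have hr0 : 0 ≤ r := by positivity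
    have e1 := h₁ A B hA
    have e2 := h₂ A B hA
    have hrA : r * |A| = 1 + |B| := by rw [hr]; field_simp
    have key : 2 * Real.pi * |A| * ‖∫ η, F η‖ ≤
        2 * Real.pi * |A| * ((C₁ + 2 * C₂) * r ^ (N + 1)) := by
      have hB := abs_nonneg B
      have hP : 0 ≤ r ^ N := by positivity
      have : 2 * Real.pi * |A| * ((C₁ + 2 * C₂) * r ^ (N + 1)) =
          2 * Real.pi * (C₁ + 2 * C₂) * r ^ N * (1 + |B|) := by rw [← hrA]; ring
      rw [this]
      calc _ ≤ _ := hle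
        _ ≤ C₁ * r ^ N + 4 * Real.pi * |B| * (C₂ * r ^ N) := by gcongr
        _ ≤ _ := by
          have h1 : 0 ≤ C₁ * r ^ N := by positivity
          have h2 : 0 ≤ C₂ * r ^ N := by positivity
          have h3 : 1 ≤ 2 * Real.pi := by linarith [Real.pi_gt_three]
          nlinarith [mul_nonneg (mul_nonneg hpi.le h1) hB, mul_nonneg hpi.le h2,
            mul_nonneg (mul_nonneg hpi.le h2) hB]
    exact le_of_mul_le_mul_left key (by positivity)

/-! ### Poisson summation on `ℤⁿ` -/

lemma fourierChar_eq_e (x : ℝ) : (Real.fourierChar x : ℂ) = e x := by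
  rw [Real.fourierChar_apply, e]
  push_cast
  ring_nf

lemma fourier_eq_integral_e {n : ℕ} (f : Vec n → ℂ) (w : Vec n) :
    𝓕 f w = ∫ v, e (-inner ℝ v w) * f v := by
  rw [Real.fourier_eq]
  simp only [Circle.smul_def, fourierChar_eq_e, smul_eq_mul]

lemma fourierInv_eq_integral_e {n : ℕ} (f : Vec n → ℂ) (w : Vec n) :
    𝓕⁻ f w = ∫ v, e (inner ℝ v w) * f v := by
  rw [Real.fourierInv_eq]
  simp only [Circle.smul_def, fourierChar_eq_e, smul_eq_mul]

lemma finite_lattice_le {n : ℕ} (ρ : ℝ) : {l : Fin n → ℤ | ‖lattice l‖ ≤ ρ}.Finite := by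
  refine (Set.finite_Icc (fun _ : Fin n => -⌊ρ⌋) fun _ => ⌊ρ⌋).subset fun l hl => ?_
  have h : ∀ i, |l i| ≤ ⌊ρ⌋ := fun i => by
    rw [Int.le_floor]
    push_cast
    exact (abs_apply_le_norm_lattice l i).trans hl
  exact ⟨fun i => (abs_le.1 (h i)).1, fun i => (abs_le.1 (h i)).2⟩

/-- The finite set of integer vectors of Euclidean norm at most `ρ`. -/
def latticeBall (n : ℕ) (ρ : ℝ) : Finset (Fin n → ℤ) := (finite_lattice_le ρ).toFinset

@[simp] lemma mem_latticeBall {n : ℕ} {ρ : ℝ} {l : Fin n → ℤ} :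
    l ∈ latticeBall n ρ ↔ ‖lattice l‖ ≤ ρ := by
  simp [latticeBall]

section Poisson

variable {n : ℕ}

/-- The unit cube with corner `l ∈ ℤⁿ`. -/
def unitCube (l : Fin n → ℤ) : Set (Fin n → ℝ) := {x | ∀ i, x i ∈ Set.Ioc (l i : ℝ) (l i + 1)}

lemma measurableSet_unitCube (l : Fin n → ℤ) : MeasurableSet (unitCube l) :=
  MeasurableSet.univ_pi' fun _ => measurableSet_Ioc

lemma pairwise_disjoint_unitCube :
    Pairwise (Function.onFun Disjoint (unitCube : (Fin n → ℤ) → Set (Fin n → ℝ))) := by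
  intro k l hkl
  refine Set.disjoint_left.2 fun x hk hl => hkl (funext fun i => ?_)
  have h1 := hk i
  have h2 := hl i
  simp only [Set.mem_Ioc] at h1 h2
  have a1 : (k i : ℝ) < l i + 1 := h1.1.trans_le h2.2
  have a2 : (l i : ℝ) < k i + 1 := h2.1.trans_le h1.2
  norm_cast at a1 a2
  omega

lemma iUnion_unitCube : ⋃ l, unitCube (n := n) l = Set.univ := by
  refine Set.eq_univ_of_forall fun x => Set.mem_iUnion.2 ⟨fun i => ⌈x i⌉ - 1, fun i => ?_⟩
  push_cast
  exact ⟨by linarith [Int.ceil_lt_add_one (x i)], by linarith [Int.le_ceil (x i)]⟩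

lemma setIntegral_unitCube {E : Type*} [NormedAddCommGroup E] [NormedSpace ℝ E]
    (F : (Fin n → ℝ) → E) (l : Fin n → ℤ) :
    ∫ x in unitCube l, F x = ∫ x in unitCube 0, F (x + fun i => (l i : ℝ)) := by
  rw [← (measurePreserving_add_right volume fun i => (l i : ℝ)).setIntegral_preimage_emb
    (measurableEmbedding_addRight _)]
  congr 2
  ext x
  refine forall_congr' fun i => ?_
  simp only [Set.mem_Ioc, Pi.add_apply, Pi.zero_apply, Int.cast_zero, zero_add]
  constructor <;> rintro ⟨h1, h2⟩ <;> constructor <;> linarith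

lemma integral_eq_setIntegral_tsum {F : (Fin n → ℝ) → ℂ} (hF : Integrable F) :
    ∫ x, F x = ∫ x in unitCube 0, ∑' l : Fin n → ℤ, F (x + fun i => (l i : ℝ)) := by
  have h1 := hasSum_integral_iUnion (μ := volume) (f := F) measurableSet_unitCube
    pairwise_disjoint_unitCube hF.integrableOn
  have h2 := hasSum_integral_iUnion (μ := volume) (f := fun x => ‖F x‖) measurableSet_unitCube
    pairwise_disjoint_unitCube hF.norm.integrableOn
  rw [iUnion_unitCube, Measure.restrict_univ] at h1 h2
  rw [funext fun l => setIntegral_unitCube F l] at h1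
  rw [funext fun l => setIntegral_unitCube (fun x => ‖F x‖) l] at h2
  rw [← integral_tsum_of_summable_integral_norm _ h2.summable, h1.tsum_eq]
  exact fun l => (hF.comp_add_right _).integrableOn

lemma continuous_tsum_lattice {f : Vec n → ℂ} (hf : Continuous f) (hc : HasCompactSupport f) :
    Continuous fun x => ∑' l, f (x + lattice l) := by
  obtain ⟨ρ, hρ⟩ := hc.isCompact.isBounded.exists_norm_le
  have hsupp : ∀ x l, f (x + lattice l) ≠ 0 → ‖lattice l‖ ≤ ρ + ‖x‖ := fun x l h => by
    have h1 := hρ _ (subset_tsupport _ h)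
    have h2 := norm_sub_le (x + lattice l) x
    rw [add_sub_cancel_left] at h2
    linarith
  have heq : (fun x => ∑' l, f (x + lattice l)) = fun x => ∑ᶠ l, f (x + lattice l) := by
    funext x
    refine tsum_eq_finsum ((finite_lattice_le (ρ + ‖x‖)).subset fun l hl => hsupp x l hl)
  rw [heq]
  refine continuous_finsum (fun l => by fun_prop) fun x => ⟨ball x 1, ball_mem_nhds x one_pos, ?_⟩
  refine (finite_lattice_le (ρ + (‖x‖ + 1))).subset ?_
  rintro l ⟨y, hy, hyx⟩
  have h1 := hsupp y l hy
  have h2 : ‖y‖ ≤ ‖x‖ + 1 := by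
    have := norm_le_norm_add_norm_sub' y x
    have := mem_ball_iff_norm.1 hyx
    linarith
  exact h1.trans (by linarith)

/-- The projection of `ℝⁿ` onto the torus `(ℝ/ℤ)ⁿ`. -/
def toTorus (x : Vec n) : UnitAddTorus (Fin n) := fun i => (x i : UnitAddCircle)

lemma isQuotientMap_toTorus : IsQuotientMap (toTorus : Vec n → UnitAddTorus (Fin n)) := by
  have h : IsOpenQuotientMap (Pi.map fun (_ : Fin n) (x : ℝ) => (x : UnitAddCircle)) :=
    IsOpenQuotientMap.piMap fun _ => QuotientAddGroup.isOpenQuotientMap_mk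
  exact (h.comp (PiLp.homeomorph 2 fun _ : Fin n => ℝ).isOpenQuotientMap).isQuotientMap

lemma mFourier_toTorus (k : Fin n → ℤ) (x : Vec n) :
    UnitAddTorus.mFourier k (toTorus x) = e (inner ℝ (lattice k) x) := by
  simp only [UnitAddTorus.mFourier, ContinuousMap.coe_mk, toTorus, fourier_coe_apply,
    PiLp.inner_apply, lattice, e_sum, RCLike.inner_apply, conj_trivial]
  refine Finset.prod_congr rfl fun i _ => ?_
  rw [e]
  push_cast
  ring_nf

/-- Poisson summation in several variables, through the Fourier series of the periodization. -/
theorem hasSum_fourier_lattice {f : Vec n → ℂ} (hf : Continuous f) (hc : HasCompactSupport f)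
    (hs : Summable fun k : Fin n → ℤ => 𝓕 f (lattice k)) (x : Vec n) :
    HasSum (fun k : Fin n → ℤ => 𝓕 f (lattice k) * e (inner ℝ (lattice k) x))
      (∑' l, f (x + lattice l)) := by
  have hper : ∀ x y : Vec n, toTorus x = toTorus y →
      ∑' l, f (x + lattice l) = ∑' l, f (y + lattice l) := by
    intro x y hxy
    have h1 : ∀ i, ∃ k : ℤ, (k : ℝ) = x i - y i := fun i => by
      have h2 : ((x i - y i : ℝ) : UnitAddCircle) = 0 := by
        rw [AddCircle.coe_sub, sub_eq_zero]
        exact congrFun hxy i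
      obtain ⟨k, hk⟩ := (AddCircle.coe_eq_zero_iff (1 : ℝ)).1 h2
      exact ⟨k, by simpa using hk⟩
    choose k hk using h1
    have hx : x = y + lattice k := by
      ext i
      simp [lattice, hk]
    rw [← (Equiv.addLeft k).tsum_eq fun l => f (y + lattice l)]
    simp only [Equiv.coe_addLeft, lattice_add, hx, add_assoc]
  let q : C(Vec n, UnitAddTorus (Fin n)) := ⟨toTorus, isQuotientMap_toTorus.continuous⟩
  have hq : IsQuotientMap q := isQuotientMap_toTorus
  let P : C(Vec n, ℂ) := ⟨fun x => ∑' l, f (x + lattice l), continuous_tsum_lattice hf hc⟩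
  have hP : Function.FactorsThrough P q := fun x y h => hper x y h
  let G : C(UnitAddTorus (Fin n), ℂ) := hq.lift P hP
  have hG : ∀ x, G (toTorus x) = ∑' l, f (x + lattice l) := fun x =>
    congrFun (congrArg DFunLike.coe (hq.lift_comp P hP)) x
  have hcoef : UnitAddTorus.mFourierCoeff G = fun k => 𝓕 f (lattice k) := by
    funext k
    have hint : Integrable fun x : Fin n → ℝ =>
        e (-inner ℝ (WithLp.toLp 2 x) (lattice k)) * f (WithLp.toLp 2 x) := by
      have h1 : Continuous fun x : Fin n → ℝ =>
          e (-inner ℝ (WithLp.toLp 2 x) (lattice k)) * f (WithLp.toLp 2 x) := by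
        fun_prop
      refine h1.integrable_of_hasCompactSupport ?_
      exact (hc.comp_homeomorph (PiLp.homeomorph 2 fun _ : Fin n => ℝ).symm).mul_left
    have h2 : 𝓕 f (lattice k) = ∫ x : Fin n → ℝ,
        e (-inner ℝ (WithLp.toLp 2 x) (lattice k)) * f (WithLp.toLp 2 x) := by
      rw [fourier_eq_integral_e]
      exact ((PiLp.volume_preserving_toLp (Fin n)).integral_comp
        (MeasurableEquiv.toLp 2 _).measurableEmbedding _).symm
    rw [h2, integral_eq_setIntegral_tsum hint,
      UnitAddTorus.mFourierCoeff_eq_integral _ _ fun _ => 0]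
    have hset : {x : Fin n → ℝ | ∀ i, x i ∈ Set.Ioc (0 : ℝ) (0 + 1)} = unitCube 0 := by
      simp [unitCube]
    rw [hset]
    refine integral_congr_ae (ae_of_all _ fun x => ?_)
    have h3 : UnitAddTorus.mFourier (-k) (fun i => ((x i : ℝ) : UnitAddCircle)) =
        e (-inner ℝ (WithLp.toLp 2 x) (lattice k)) := by
      have := mFourier_toTorus (-k) (WithLp.toLp 2 x)
      have hneg : lattice (-k) = -lattice k := by ext i; simp [lattice]
      rw [hneg, inner_neg_left, real_inner_comm] at this
      exact this
    have h4 : G (fun i => ((x i : ℝ) : UnitAddCircle)) =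
        ∑' l, f (WithLp.toLp 2 x + lattice l) := hG (WithLp.toLp 2 x)
    simp only [smul_eq_mul]
    rw [h3, h4, ← tsum_mul_left]
    refine tsum_congr fun l => ?_
    have h5 : WithLp.toLp 2 (x + fun i => (l i : ℝ)) = WithLp.toLp 2 x + lattice l := rfl
    rw [h5, inner_add_left, inner_lattice, neg_add, ← Int.cast_neg, e_add_intCast]
  have h := UnitAddTorus.hasSum_mFourier_series_apply_of_summable
    (f := G) (by rw [hcoef]; exact hs) (toTorus x)
  simpa only [hcoef, hG, mFourier_toTorus, smul_eq_mul] using h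

end Poisson

/-! ### Quadratic Gauss sums -/

/-- Modulus of a quadratic Gauss sum of odd modulus: in `|G|²` the substitution `r = s + u`
leaves a linear sum in `s`, which vanishes unless `2pu = 0`. -/
lemma norm_sum_stdAddChar_quadratic {q : ℕ} [NeZero q] (hq : Odd q) {p : ℤ}
    (hp : Int.gcd p q = 1) (b : ZMod q) :
    ‖∑ r : ZMod q, ZMod.stdAddChar ((p : ZMod q) * r ^ 2 + b * r)‖ = √q := by
  have hunit : IsUnit (2 * (p : ZMod q)) := by
    refine IsUnit.mul ?_ ?_
    · have : IsUnit ((2 : ℕ) : ZMod q) :=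
        (ZMod.isUnit_iff_coprime 2 q).2 (Nat.coprime_two_left.2 hq)
      simpa using this
    · rw [ZMod.coe_int_isUnit_iff_isCoprime]
      exact (Int.isCoprime_iff_gcd_eq_one.2 hp).symm
  set χ : AddChar (ZMod q) ℂ := ZMod.stdAddChar with hχ
  have hconj : ∀ x, starRingEnd ℂ (χ x) = χ (-x) := fun x => by
    rw [AddChar.map_neg_eq_conj]
  have hsq : ((∑ r : ZMod q, χ ((p : ZMod q) * r ^ 2 + b * r)) *
      starRingEnd ℂ (∑ r : ZMod q, χ ((p : ZMod q) * r ^ 2 + b * r))) = q := by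
    rw [map_sum, Finset.sum_mul_sum, Finset.sum_comm]
    have h1 : ∀ s : ZMod q, (∑ r : ZMod q, χ ((p : ZMod q) * r ^ 2 + b * r) *
        starRingEnd ℂ (χ ((p : ZMod q) * s ^ 2 + b * s))) =
        ∑ u : ZMod q, χ ((p : ZMod q) * u ^ 2 + b * u) * χ (s * (2 * (p : ZMod q) * u)) := by
      intro s
      rw [← Equiv.sum_comp (Equiv.addRight s)]
      refine Finset.sum_congr rfl fun u _ => ?_
      rw [hconj, ← AddChar.map_add_eq_mul, ← AddChar.map_add_eq_mul]
      congr 1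
      simp only [Equiv.coe_addRight]
      ring
    rw [Finset.sum_congr rfl fun s _ => h1 s, Finset.sum_comm]
    have h2 : ∀ u : ZMod q, (∑ s : ZMod q, χ ((p : ZMod q) * u ^ 2 + b * u) *
        χ (s * (2 * (p : ZMod q) * u))) = if u = 0 then (q : ℂ) else 0 := by
      intro u
      rw [← Finset.mul_sum, AddChar.sum_mulShift _ (ZMod.isPrimitive_stdAddChar q)]
      by_cases hu : u = 0
      · simp [hu, ZMod.card]
      · have hu' : ¬ 2 * (p : ZMod q) * u = 0 := fun h => hu (hunit.mul_right_eq_zero.1 h)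
        simp [hu, hu']
    simp [Finset.sum_congr rfl fun u _ => h2 u]
  rw [Complex.mul_conj, Complex.normSq_eq_norm_sq] at hsq
  have h3 : ‖∑ r : ZMod q, χ ((p : ZMod q) * r ^ 2 + b * r)‖ ^ 2 = q := by exact_mod_cast hsq
  rw [← h3, Real.sqrt_sq (norm_nonneg _)]

lemma sum_fin_e_eq_sum_stdAddChar {q : ℕ} [NeZero q] (p b : ℤ) :
    ∑ r : Fin q, e ((p * (r : ℝ) ^ 2 + b * r) / q) =
      ∑ r : ZMod q, ZMod.stdAddChar ((p : ZMod q) * r ^ 2 + (b : ZMod q) * r) := by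
  refine Fintype.sum_bijective (fun r : Fin q => ((r : ℕ) : ZMod q)) ?_ _ _ fun r => ?_
  · rw [Fintype.bijective_iff_injective_and_card]
    refine ⟨fun r s h => ?_, by simp [ZMod.card]⟩
    have h' := (ZMod.natCast_eq_natCast_iff' _ _ _).1 h
    rw [Nat.mod_eq_of_lt r.2, Nat.mod_eq_of_lt s.2] at h'
    exact Fin.ext h'
  · have h := ZMod.stdAddChar_coe (N := q) (p * (r : ℕ) ^ 2 + b * (r : ℕ))
    push_cast at h
    rw [h, e]
    push_cast
    ring_nf

/-- The Gauss sum in several variables `∑_r e((p|r|² + v·r)/q)`, over `r ∈ {0, …, q-1}ᵈ`. -/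
def gaussSumVec {d : ℕ} (q : ℕ) (p : ℤ) (v : Fin d → ℤ) : ℂ :=
  ∑ r : Fin d → Fin q, ∏ i, e ((p * (r i : ℝ) ^ 2 + v i * r i) / q)

lemma norm_gaussSumVec {d q : ℕ} (hq : Odd q) {p : ℤ} (hp : Int.gcd p q = 1)
    (v : Fin d → ℤ) : ‖gaussSumVec q p v‖ = √q ^ d := by
  have : NeZero q := ⟨hq.pos.ne'⟩
  rw [gaussSumVec, ← Fintype.prod_sum (fun i (r : Fin q) => e ((p * (r : ℝ) ^ 2 + v i * r) / q)),
    norm_prod]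
  simp [sum_fin_e_eq_sum_stdAddChar, norm_sum_stdAddChar_quadratic hq hp]

/-! ### Theta sums at rational times -/

section Theta

variable {d : ℕ}

lemma summable_norm_lattice_inv_pow :
    Summable fun k : Fin d → ℤ => ‖lattice k‖⁻¹ ^ (d + 1) := by
  let b := (EuclideanSpace.basisFun (Fin d) ℝ).toBasis
  let L : Submodule ℤ (Vec d) := Submodule.span ℤ (Set.range b)
  have hmem : ∀ k : Fin d → ℤ, lattice k ∈ L := fun k => by
    have h : lattice k = ∑ i, k i • b i := by
      ext j
      simp [lattice, b, Finset.sum_apply, Pi.single_apply]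
    rw [h]
    exact Submodule.sum_mem _ fun i _ => Submodule.smul_mem _ _ (Submodule.subset_span ⟨i, rfl⟩)
  have hrank : Module.finrank ℤ L < d + 1 := by
    rw [ZLattice.rank ℝ L]
    simp
  have hs := ZLattice.summable_norm_pow_inv L (d + 1) hrank
  have hinj : Function.Injective fun k : Fin d → ℤ => (⟨lattice k, hmem k⟩ : L) := by
    intro k l h
    have h' : lattice k = lattice l := congrArg Subtype.val h
    funext i
    have := congrArg (fun x : Vec d => x i) h'
    simpa [lattice] using this
  simpa [Function.comp_def] using hs.comp_injective hinj

/-- Values of a Schwartz function on the nonzero points of a sparse lattice, even a translated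
one, have a small sum. -/
lemma exists_tsum_norm_lattice_le (g : 𝓢(Vec d, ℂ)) {ε : ℝ} (hε : 0 < ε) :
    ∃ h₀ : ℝ, 0 < h₀ ∧ ∀ h : ℝ, 0 < h → (d = 0 ∨ h ≤ h₀) → ∀ y : Vec d, ‖y‖ ≤ 2 →
      Summable (fun k : Fin d → ℤ => ‖g (h⁻¹ • lattice k - y)‖) ∧
      ∑' k : Fin d → ℤ, (if k = 0 then 0 else ‖g (h⁻¹ • lattice k - y)‖) ≤ ε := by
  obtain ⟨C, hC, hdec⟩ := g.decay (d + 1) 0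
  simp only [norm_iteratedFDeriv_zero] at hdec
  set T := ∑' k : Fin d → ℤ, ‖lattice k‖⁻¹ ^ (d + 1) with hT
  have hT0 : 0 ≤ T := tsum_nonneg fun _ => by positivity
  refine ⟨min (1 / 4) (ε / (C * 2 ^ (d + 1) * (T + 1))), by positivity, fun h h0 hh y hy => ?_⟩
  rcases hh with rfl | hh
  -- for `d = 0` the lattice is a single point, whatever `h` is
  · refine ⟨Summable.of_finite, ?_⟩
    rw [tsum_fintype, Finset.sum_eq_zero fun k _ => if_pos (Subsingleton.elim k 0)]
    exact hε.le
  have hh1 : h ≤ 1 / 4 := hh.trans (min_le_left _ _)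
  have hh2 := hh.trans (min_le_right _ _)
  have key : ∀ k : Fin d → ℤ, k ≠ 0 → ‖g (h⁻¹ • lattice k - y)‖ ≤
      C * 2 ^ (d + 1) * h * ‖lattice k‖⁻¹ ^ (d + 1) := by
    intro k hk
    have hk1 := one_le_norm_lattice hk
    have hk0 : 0 < ‖lattice k‖ := by linarith
    have h1 : ‖lattice k‖ / (2 * h) ≤ ‖h⁻¹ • lattice k - y‖ := by
      have h2 := norm_sub_norm_le (h⁻¹ • lattice k) y
      rw [norm_smul, norm_inv, Real.norm_of_nonneg h0.le] at h2
      have h3 : 2 ≤ ‖lattice k‖ / (2 * h) := by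
        rw [le_div_iff₀ (by positivity)]
        linarith
      have h4 : h⁻¹ * ‖lattice k‖ = ‖lattice k‖ / (2 * h) + ‖lattice k‖ / (2 * h) := by
        field_simp
        ring
      linarith
    have h5 := hdec (h⁻¹ • lattice k - y)
    have h6 : (‖lattice k‖ / (2 * h)) ^ (d + 1) * ‖g (h⁻¹ • lattice k - y)‖ ≤ C :=
      le_trans (by gcongr) h5
    have h7 : ‖g (h⁻¹ • lattice k - y)‖ ≤ C / (‖lattice k‖ / (2 * h)) ^ (d + 1) := by
      rw [le_div_iff₀ (by positivity)]
      linarith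
    refine h7.trans ?_
    have h8 : C / (‖lattice k‖ / (2 * h)) ^ (d + 1) =
        C * 2 ^ (d + 1) * h ^ (d + 1) * ‖lattice k‖⁻¹ ^ (d + 1) := by
      rw [div_pow, mul_pow, inv_pow]
      field_simp
    rw [h8]
    have h9 : h ^ (d + 1) ≤ h := by
      rw [pow_succ]
      exact mul_le_of_le_one_left h0.le (pow_le_one₀ h0.le (by linarith))
    gcongr
  have hsum0 := summable_norm_lattice_inv_pow (d := d)
  constructor
  · refine ((hsum0.mul_left (C * 2 ^ (d + 1) * h)).add
      (hasSum_ite_eq (0 : Fin d → ℤ) ‖g (-y)‖).summable).of_nonneg_of_le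
      (fun _ => norm_nonneg _) fun k => ?_
    by_cases hk : k = 0
    · simp [hk]
    · simpa [hk] using key k hk
  · have hle : ∀ k : Fin d → ℤ, (if k = 0 then 0 else ‖g (h⁻¹ • lattice k - y)‖) ≤
        C * 2 ^ (d + 1) * h * ‖lattice k‖⁻¹ ^ (d + 1) := fun k => by
      split_ifs with hk
      · positivity
      · exact key k hk
    have hmaj := hsum0.mul_left (C * 2 ^ (d + 1) * h)
    refine ((hmaj.of_nonneg_of_le (fun k => by split_ifs <;> positivity) hle).tsum_le_tsum hle
      hmaj).trans ?_
    rw [tsum_mul_left, ← hT]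
    rw [le_div_iff₀ (by positivity)] at hh2
    have : 0 ≤ C * 2 ^ (d + 1) * h := by positivity
    nlinarith

lemma fourier_dilate_modulate (ψ : Vec d → ℂ) {h : ℝ} (h0 : 0 < h) (y w : Vec d) :
    𝓕 (fun z => ψ (h • z) * e (h * inner ℝ z y)) w =
      ((h ^ d)⁻¹ : ℝ) * 𝓕 ψ (h⁻¹ • w - y) := by
  rw [fourier_eq_integral_e, fourier_eq_integral_e]
  have h1 := Measure.integral_comp_smul (volume : Measure (Vec d))
    (fun u => e (-inner ℝ u (h⁻¹ • w - y)) * ψ u) h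
  rw [finrank_euclideanSpace_fin, abs_of_pos (by positivity), Complex.real_smul] at h1
  rw [← h1]
  refine integral_congr_ae (ae_of_all _ fun z => ?_)
  simp only
  have h2 : -inner ℝ (h • z) (h⁻¹ • w - y) = -inner ℝ z w + h * inner ℝ z y := by
    rw [inner_sub_right, real_inner_smul_left, real_inner_smul_left, real_inner_smul_right]
    field_simp
    ring
  rw [h2, e_add]
  ring

/-- Euclidean division by `q` in each coordinate. -/
def latticeDivMod (d q : ℕ) [NeZero q] :
    (Fin d → ℤ) ≃ (Fin d → Fin q) × (Fin d → ℤ) :=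
  ((Equiv.piCongrRight fun _ => Int.divModEquiv q).trans
    (Equiv.arrowProdEquivProdArrow _ _ _)).trans (Equiv.prodComm _ _)

lemma latticeDivMod_symm_apply {q : ℕ} [NeZero q] (r : Fin d → Fin q) (k : Fin d → ℤ) (i : Fin d) :
    ((latticeDivMod d q).symm (r, k) i : ℤ) = (r i : ℕ) + q * k i := by
  simp [latticeDivMod, Int.divModEquiv, Equiv.arrowProdEquivProdArrow]
  ring

lemma tsum_latticeDivMod {q : ℕ} [NeZero q] {Φ : (Fin d → ℤ) → ℂ} (hΦ : Summable Φ) :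
    ∑' l, Φ l = ∑ r : Fin d → Fin q, ∑' k : Fin d → ℤ, Φ ((latticeDivMod d q).symm (r, k)) := by
  have h := (latticeDivMod d q).symm.summable_iff.2 hΦ
  rw [← (latticeDivMod d q).symm.tsum_eq]
  exact (Summable.tsum_prod h).trans (tsum_fintype _)

/-- Poisson summation along residue classes mod `q`. The theta sum with coefficients
`e((p|l|² + v·l)/q)` equals, up to the total contribution of the nonzero dual frequencies, a Gauss
sum times the integral of the amplitude. All Gauss sums involved have the same modulus. -/
lemma norm_tsum_theta_sub_le {ψ : 𝓢(Vec d, ℂ)} (hψ : HasCompactSupport ψ) {q : ℕ} (hq : Odd q)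
    {p : ℤ} (hp : Int.gcd p q = 1) (v : Fin d → ℤ) {h : ℝ} (h0 : 0 < h) (y : Vec d)
    (hs : Summable fun k : Fin d → ℤ => ‖(𝓕 ψ) (h⁻¹ • lattice k - y)‖) :
    ‖(∑' l : Fin d → ℤ, ψ ((h / q) • lattice l) * e (h / q * inner ℝ (lattice l) y) *
        ∏ i, e ((p * (l i : ℝ) ^ 2 + v i * l i) / q)) -
      gaussSumVec q p v * (((h ^ d)⁻¹ : ℝ) * (𝓕 ψ) (-y))‖ ≤
    √q ^ d * ((h ^ d)⁻¹ *
      ∑' k : Fin d → ℤ, if k = 0 then 0 else ‖(𝓕 ψ) (h⁻¹ • lattice k - y)‖) := by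
  have : NeZero q := ⟨hq.pos.ne'⟩
  have hq0 : (0 : ℝ) < q := by exact_mod_cast hq.pos
  set F : Vec d → ℂ := fun z => ψ (h • z) * e (h * inner ℝ z y) with hF
  have hFc : Continuous F := by
    have := ψ.continuous
    fun_prop
  have hFs : HasCompactSupport F := by
    have h1 : HasCompactSupport fun z => ψ (h • z) := hψ.comp_smul h0.ne'
    exact h1.mul_right
  have hFhat : ∀ k : Fin d → ℤ, 𝓕 F (lattice k) =
      ((h ^ d)⁻¹ : ℝ) * (𝓕 ψ) (h⁻¹ • lattice k - y) := fun k =>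
    fourier_dilate_modulate ψ h0 y (lattice k)
  have hFsum : Summable fun k : Fin d → ℤ => ‖𝓕 F (lattice k)‖ := by
    simp only [hFhat, norm_mul]
    exact hs.mul_left _
  have hpois := fun x => hasSum_fourier_lattice hFc hFs hFsum.of_norm x
  -- the summand along the residue class of `r`
  have hres : ∀ (r : Fin d → Fin q) (k : Fin d → ℤ),
      ψ ((h / q) • lattice ((latticeDivMod d q).symm (r, k))) *
        e (h / q * inner ℝ (lattice ((latticeDivMod d q).symm (r, k))) y) *
        ∏ i, e ((p * ((latticeDivMod d q).symm (r, k) i : ℝ) ^ 2 +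
          v i * (latticeDivMod d q).symm (r, k) i) / q) =
      (∏ i, e ((p * (r i : ℝ) ^ 2 + v i * r i) / q)) *
        F ((q : ℝ)⁻¹ • lattice (fun i => ((r i : ℕ) : ℤ)) + lattice k) := by
    intro r k
    have h1 : lattice ((latticeDivMod d q).symm (r, k)) =
        (q : ℝ) • ((q : ℝ)⁻¹ • lattice (fun i => ((r i : ℕ) : ℤ)) + lattice k) := by
      ext i
      simp only [lattice, latticeDivMod_symm_apply, PiLp.smul_apply, PiLp.add_apply, smul_eq_mul]
      push_cast
      field_simp
    have h2 : ∀ i, e ((p * ((latticeDivMod d q).symm (r, k) i : ℝ) ^ 2 +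
        v i * (latticeDivMod d q).symm (r, k) i) / q) =
        e ((p * (r i : ℝ) ^ 2 + v i * r i) / q) := fun i => by
      rw [latticeDivMod_symm_apply]
      refine Eq.trans ?_
        (e_add_intCast _ (2 * p * (r i : ℕ) * k i + p * q * k i ^ 2 + v i * k i))
      congr 1
      push_cast
      field_simp
      ring
    rw [h1, Finset.prod_congr rfl fun i _ => h2 i, hF, smul_smul, real_inner_smul_left,
      div_mul_cancel₀ _ hq0.ne', ← mul_assoc, div_mul_cancel₀ _ hq0.ne']
    ring
  have hΓ : ∀ k : Fin d → ℤ, (∑ r : Fin d → Fin q, (∏ i, e ((p * (r i : ℝ) ^ 2 + v i * r i) / q)) *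
      e (inner ℝ (lattice k) ((q : ℝ)⁻¹ • lattice fun i => ((r i : ℕ) : ℤ)))) =
      gaussSumVec q p (v + k) := by
    intro k
    refine Finset.sum_congr rfl fun r _ => ?_
    rw [real_inner_smul_right, inner_lattice]
    push_cast
    rw [Finset.mul_sum, e_sum, ← Finset.prod_mul_distrib]
    refine Finset.prod_congr rfl fun i _ => ?_
    rw [← e_add, Pi.add_apply]
    congr 1
    push_cast
    field_simp
    ring
  set x : (Fin d → Fin q) → Vec d := fun r => (q : ℝ)⁻¹ • lattice fun i => ((r i : ℕ) : ℤ) with hx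
  set a : (Fin d → Fin q) → ℂ := fun r => ∏ i, e ((p * (r i : ℝ) ^ 2 + v i * r i) / q) with ha
  have hΦ : Summable fun l : Fin d → ℤ => ψ ((h / q) • lattice l) *
      e (h / q * inner ℝ (lattice l) y) * ∏ i, e ((p * (l i : ℝ) ^ 2 + v i * l i) / q) := by
    obtain ⟨ρ, hρ⟩ := hψ.isCompact.isBounded.exists_norm_le
    refine summable_of_hasFiniteSupport ((finite_lattice_le (ρ / (h / q))).subset fun l hl => ?_)
    have h1 := hρ _ (subset_tsupport _ (left_ne_zero_of_mul (left_ne_zero_of_mul hl)))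
    rw [norm_smul, Real.norm_of_nonneg (by positivity)] at h1
    rw [Set.mem_ofPred_eq, le_div_iff₀ (by positivity)]
    linarith
  have hS : (∑' l : Fin d → ℤ, ψ ((h / q) • lattice l) * e (h / q * inner ℝ (lattice l) y) *
        ∏ i, e ((p * (l i : ℝ) ^ 2 + v i * l i) / q)) =
      ∑' k : Fin d → ℤ, 𝓕 F (lattice k) * gaussSumVec q p (v + k) := by
    rw [tsum_latticeDivMod (q := q) hΦ]
    have h1 : HasSum (fun k : Fin d → ℤ => ∑ r : Fin d → Fin q,
        a r * (𝓕 F (lattice k) * e (inner ℝ (lattice k) (x r))))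
        (∑ r : Fin d → Fin q, a r * ∑' k, F (x r + lattice k)) :=
      hasSum_sum fun r _ => (hpois (x r)).mul_left (a r)
    have h2 : ∀ r : Fin d → Fin q, ∑' k : Fin d → ℤ, a r * F (x r + lattice k) =
        a r * ∑' k, F (x r + lattice k) := fun r => tsum_mul_left
    simp only [hres]
    rw [Finset.sum_congr rfl fun r _ => h2 r, ← h1.tsum_eq]
    refine tsum_congr fun k => ?_
    rw [← hΓ k, Finset.mul_sum]
    refine Finset.sum_congr rfl fun r _ => ?_
    ring
  have hnorm : ∀ k : Fin d → ℤ, ‖𝓕 F (lattice k) * gaussSumVec q p (v + k)‖ =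
      √q ^ d * ((h ^ d)⁻¹ * ‖(𝓕 ψ) (h⁻¹ • lattice k - y)‖) := fun k => by
    rw [norm_mul, norm_gaussSumVec hq hp, hFhat, norm_mul, Complex.norm_real,
      Real.norm_of_nonneg (by positivity)]
    ring
  have hsum2 : Summable fun k : Fin d → ℤ => 𝓕 F (lattice k) * gaussSumVec q p (v + k) := by
    rw [← summable_norm_iff]
    simp only [hnorm]
    exact (hs.mul_left _).mul_left _
  rw [hS, hsum2.tsum_eq_add_tsum_ite 0]
  have hzero : 𝓕 F (lattice (0 : Fin d → ℤ)) * gaussSumVec q p (v + 0) =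
      gaussSumVec q p v * (((h ^ d)⁻¹ : ℝ) * (𝓕 ψ) (-y)) := by
    rw [hFhat, add_zero, lattice_zero, smul_zero, zero_sub]
    ring
  rw [hzero, add_sub_cancel_left, ← tsum_mul_left, ← tsum_mul_left]
  have hcongr : ∀ k : Fin d → ℤ,
      ‖if k = 0 then 0 else 𝓕 F (lattice k) * gaussSumVec q p (v + k)‖ =
      √q ^ d * ((h ^ d)⁻¹ * if k = 0 then 0 else ‖(𝓕 ψ) (h⁻¹ • lattice k - y)‖) := fun k => by
    split_ifs
    · simp
    · exact hnorm k
  have hsum3 : Summable fun k : Fin d → ℤ =>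
      ‖if k = 0 then 0 else 𝓕 F (lattice k) * gaussSumVec q p (v + k)‖ := by
    refine hsum2.norm.of_nonneg_of_le (fun _ => norm_nonneg _) fun k => ?_
    split_ifs
    · rw [norm_zero]
      exact norm_nonneg _
    · exact le_rfl
  exact (norm_tsum_le_tsum_norm hsum3).trans_eq (tsum_congr hcongr)

end Theta

/-! ### Counting integer vectors in a ball -/

lemma card_piFinset_Icc (n : ℕ) {k : ℤ} (hk : 0 ≤ k) :
    ((Fintype.piFinset fun _ : Fin n => Finset.Icc (-k) k).card : ℝ) = (2 * k + 1) ^ n := by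
  rw [Fintype.card_piFinset_const, Int.card_Icc]
  have h : ((k + 1 - -k).toNat : ℝ) = 2 * k + 1 := by
    have h1 : ((k + 1 - -k).toNat : ℤ) = 2 * k + 1 := by omega
    exact_mod_cast h1
  rw [Nat.cast_pow, h]

lemma card_latticeBall_le (n : ℕ) {ρ : ℝ} (hρ : 0 ≤ ρ) :
    ((latticeBall n ρ).card : ℝ) ≤ (2 * ρ + 1) ^ n := by
  have hsub : latticeBall n ρ ⊆ Fintype.piFinset fun _ : Fin n => Finset.Icc (-⌊ρ⌋) ⌊ρ⌋ := by
    intro l hl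
    rw [Fintype.mem_piFinset]
    intro i
    rw [Finset.mem_Icc, ← abs_le, Int.le_floor]
    push_cast
    exact (abs_apply_le_norm_lattice l i).trans (mem_latticeBall.1 hl)
  calc ((latticeBall n ρ).card : ℝ) ≤ _ := Nat.cast_le.2 (Finset.card_le_card hsub)
    _ = (2 * (⌊ρ⌋ : ℝ) + 1) ^ n := card_piFinset_Icc n (Int.floor_nonneg.2 hρ)
    _ ≤ _ := by
      have h1 := Int.floor_le ρ
      have h2 : (0 : ℝ) ≤ ⌊ρ⌋ := by exact_mod_cast Int.floor_nonneg.2 hρ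
      gcongr

lemma le_card_latticeBall (n : ℕ) {ρ : ℝ} (hρ : 0 ≤ ρ) :
    (ρ / (n + 1)) ^ n ≤ (latticeBall n ρ).card := by
  set σ := ρ / (n + 1) with hσ
  have hσ0 : 0 ≤ σ := by positivity
  have hfl : 0 ≤ ⌊σ⌋ := Int.floor_nonneg.2 hσ0
  have hsub : (Fintype.piFinset fun _ : Fin n => Finset.Icc (-⌊σ⌋) ⌊σ⌋) ⊆ latticeBall n ρ := by
    intro l hl
    rw [Fintype.mem_piFinset] at hl
    rw [mem_latticeBall]
    refine le_of_sq_le_sq ?_ hρ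
    rw [norm_sq_lattice]
    push_cast
    have h1 : ∀ i, (l i : ℝ) ^ 2 ≤ σ ^ 2 := fun i => by
      have h2 := hl i
      rw [Finset.mem_Icc, ← abs_le, Int.le_floor] at h2
      rw [← sq_abs]
      push_cast at h2
      gcongr
    refine (Finset.sum_le_sum fun i _ => h1 i).trans ?_
    have h3 : ρ = σ * (n + 1) := by rw [hσ]; field_simp
    rw [Finset.sum_const, Finset.card_univ, Fintype.card_fin, nsmul_eq_mul, h3, mul_pow]
    have h4 : (0 : ℝ) ≤ n := Nat.cast_nonneg n
    nlinarith [mul_nonneg h4 (sq_nonneg σ), mul_nonneg (mul_nonneg h4 h4) (sq_nonneg σ),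
      sq_nonneg σ]
  calc σ ^ n ≤ (2 * (⌊σ⌋ : ℝ) + 1) ^ n := by
        have h1 := Int.lt_floor_add_one σ
        have h2 : (0 : ℝ) ≤ ⌊σ⌋ := by exact_mod_cast hfl
        gcongr
        linarith
    _ = _ := (card_piFinset_Icc n hfl).symm
    _ ≤ _ := Nat.cast_le.2 (Finset.card_le_card hsub)

/-! ### Sums of translated bumps -/

section Comb

variable {n : ℕ}

/-- The weighted sum of the translates of `χ` to the points `D l`, `l ∈ ℤⁿ`, `|l| ≤ ρ`. -/
def comb (ρ : ℝ) (w : (Fin n → ℤ) → ℝ) (D : ℝ) (χ : Vec n → ℂ) (ξ : Vec n) : ℂ :=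
  ∑ l ∈ latticeBall n ρ, (w l : ℂ) * χ (ξ - D • lattice l)

variable {ρ : ℝ} {w : (Fin n → ℤ) → ℝ} {D : ℝ}

lemma contDiff_comb (χ : 𝓢(Vec n, ℂ)) : ContDiff ℝ (⊤ : ℕ∞) (comb ρ w D χ) := by
  unfold comb
  refine ContDiff.sum fun l _ => contDiff_const.mul ?_
  exact (χ.smooth ⊤).comp (contDiff_id.sub contDiff_const)

lemma norm_le_of_comb_ne_zero {χ : Vec n → ℂ} {c : ℝ} (hχ : Function.support χ ⊆ closedBall 0 c)
    (hD : 0 ≤ D) {ξ : Vec n} (hξ : comb ρ w D χ ξ ≠ 0) : ‖ξ‖ ≤ c + D * ρ := by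
  obtain ⟨l, hl, hne⟩ := Finset.exists_ne_zero_of_sum_ne_zero hξ
  have h1 : ‖ξ - D • lattice l‖ ≤ c := by simpa using hχ (right_ne_zero_of_mul hne)
  have h2 : ‖D • lattice l‖ ≤ D * ρ := by
    rw [norm_smul, Real.norm_of_nonneg hD]
    exact mul_le_mul_of_nonneg_left (mem_latticeBall.1 hl) hD
  have h3 := norm_le_norm_sub_add ξ (D • lattice l)
  linarith

lemma integrable_comb (χ : 𝓢(Vec n, ℂ)) : Integrable (comb ρ w D χ) :=
  integrable_finsetSum _ fun l _ => (χ.integrable.comp_sub_right (D • lattice l)).const_mul _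

lemma integral_norm_comb_le (χ : 𝓢(Vec n, ℂ)) (hρ : 0 ≤ ρ) {M : ℝ} (hM : ∀ l, |w l| ≤ M) :
    ∫ ξ, ‖comb ρ w D χ ξ‖ ≤ (2 * ρ + 1) ^ n * (M * ∫ η, ‖χ η‖) := by
  have hM0 : 0 ≤ M := (abs_nonneg _).trans (hM 0)
  have hI : 0 ≤ ∫ η, ‖χ η‖ := integral_nonneg fun _ => norm_nonneg _
  have hint : ∀ l, Integrable fun ξ => ‖(w l : ℂ) * χ (ξ - D • lattice l)‖ := fun l =>
    ((χ.integrable.comp_sub_right (D • lattice l)).const_mul _).norm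
  calc ∫ ξ, ‖comb ρ w D χ ξ‖
      ≤ ∫ ξ, ∑ l ∈ latticeBall n ρ, ‖(w l : ℂ) * χ (ξ - D • lattice l)‖ :=
        integral_mono (integrable_comb χ).norm (integrable_finsetSum _ fun l _ => hint l)
          fun ξ => norm_sum_le _ _
    _ = ∑ l ∈ latticeBall n ρ, |w l| * ∫ η, ‖χ η‖ := by
        rw [integral_finsetSum _ fun l _ => hint l]
        refine Finset.sum_congr rfl fun l _ => ?_
        simp only [norm_mul, Complex.norm_real, Real.norm_eq_abs]
        rw [integral_const_mul, integral_sub_right_eq_self (fun ξ => ‖χ ξ‖)]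
    _ ≤ ∑ l ∈ latticeBall n ρ, M * ∫ η, ‖χ η‖ :=
        Finset.sum_le_sum fun l _ => mul_le_mul_of_nonneg_right (hM l) hI
    _ ≤ _ := by
        rw [Finset.sum_const, nsmul_eq_mul]
        exact mul_le_mul_of_nonneg_right (card_latticeBall_le n hρ) (mul_nonneg hM0 hI)

/-- The translates have disjoint supports, so the square of the `L²` norm is additive. -/
lemma integral_norm_sq_comb (χ : 𝓢(Vec n, ℂ)) {c : ℝ} (hχ : Function.support χ ⊆ closedBall 0 c)
    (hc : c < 1 / 2) (hD : 1 ≤ D) :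
    ∫ ξ, ‖comb ρ w D χ ξ‖ ^ 2 = (∑ l ∈ latticeBall n ρ, w l ^ 2) * ∫ η, ‖χ η‖ ^ 2 := by
  have hpt : ∀ ξ, ‖comb ρ w D χ ξ‖ ^ 2 =
      ∑ l ∈ latticeBall n ρ, w l ^ 2 * ‖χ (ξ - D • lattice l)‖ ^ 2 := by
    intro ξ
    by_cases hex : ∃ l ∈ latticeBall n ρ, χ (ξ - D • lattice l) ≠ 0
    · obtain ⟨l₀, hl₀, hne⟩ := hex
      have hz : ∀ l, l ≠ l₀ → χ (ξ - D • lattice l) = 0 := by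
        intro l hl
        by_contra hl'
        have h1 : ‖ξ - D • lattice l₀‖ ≤ c := by simpa using hχ hne
        have h2 : ‖ξ - D • lattice l‖ ≤ c := by simpa using hχ hl'
        have h3 := norm_sub_le (ξ - D • lattice l₀) (ξ - D • lattice l)
        have h4 : (ξ - D • lattice l₀) - (ξ - D • lattice l) = D • lattice (l - l₀) := by
          rw [lattice_sub, smul_sub]
          abel
        rw [h4, norm_smul, Real.norm_of_nonneg (by linarith)] at h3
        have h5 := one_le_norm_lattice (sub_ne_zero.2 hl)
        nlinarith
      rw [comb, Finset.sum_eq_single_of_mem l₀ hl₀ fun l _ hl => by rw [hz l hl, mul_zero],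
        Finset.sum_eq_single_of_mem l₀ hl₀ fun l _ hl => by rw [hz l hl, norm_zero]; ring,
        norm_mul, Complex.norm_real, mul_pow, Real.norm_eq_abs, sq_abs]
    · push Not at hex
      rw [comb, Finset.sum_eq_zero fun l hl => by rw [hex l hl, mul_zero],
        Finset.sum_eq_zero fun l hl => by rw [hex l hl, norm_zero]; ring]
      simp
  have hsq : Integrable fun η => ‖χ η‖ ^ 2 :=
    (memLp_two_iff_integrable_sq_norm χ.continuous.aestronglyMeasurable).1 (χ.memLp 2)
  simp only [hpt]
  rw [integral_finsetSum _ fun l _ => (hsq.comp_sub_right (D • lattice l)).const_mul _,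
    Finset.sum_mul]
  refine Finset.sum_congr rfl fun l _ => ?_
  rw [integral_const_mul, integral_sub_right_eq_self (fun ξ => ‖χ ξ‖ ^ 2)]

lemma integrable_mul_e {V : Type*} [NormedAddCommGroup V] [MeasurableSpace V] [BorelSpace V]
    [SecondCountableTopology V] {μ : Measure V} {f : V → ℂ} (hf : Integrable f μ) {θ : V → ℝ}
    (hθ : Continuous θ) : Integrable (fun v => f v * e (θ v)) μ := by
  refine hf.mono (hf.aestronglyMeasurable.mul (by fun_prop)) ?_
  filter_upwards with v
  simp [norm_e]

/-- Each translate `ξ = D l + η` evolves separately; the phase is expanded around `D l`. -/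
lemma integral_comb_mul_e (χ : 𝓢(Vec n, ℂ)) (t : ℝ) (x : Vec n) :
    ∫ ξ, comb ρ w D χ ξ * e (inner ℝ x ξ + t * ‖ξ‖ ^ 2) =
      ∑ l ∈ latticeBall n ρ, (w l : ℂ) *
        (e (D * inner ℝ x (lattice l) + t * D ^ 2 * ‖lattice l‖ ^ 2) *
        ∫ η, χ η * e (inner ℝ x η + 2 * t * D * inner ℝ (lattice l) η + t * ‖η‖ ^ 2)) := by
  simp only [comb, Finset.sum_mul]
  rw [integral_finsetSum _ fun l _ => integrable_mul_e
    ((χ.integrable.comp_sub_right (D • lattice l)).const_mul _) (by fun_prop)]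
  refine Finset.sum_congr rfl fun l _ => ?_
  simp only [mul_assoc]
  rw [integral_const_mul]
  congr 1
  rw [← integral_add_right_eq_self _ (D • lattice l), ← integral_const_mul]
  refine integral_congr_ae (ae_of_all _ fun η => ?_)
  simp only [add_sub_cancel_right]
  have h : inner ℝ x (η + D • lattice l) + t * ‖η + D • lattice l‖ ^ 2 =
      (D * inner ℝ x (lattice l) + t * (D ^ 2 * ‖lattice l‖ ^ 2)) +
      (inner ℝ x η + (2 * (t * (D * inner ℝ (lattice l) η)) + t * ‖η‖ ^ 2)) := by
    rw [norm_add_sq_real, inner_add_right, real_inner_smul_right, real_inner_smul_right,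
      norm_smul, mul_pow, Real.norm_eq_abs, sq_abs, real_inner_comm (lattice l) η]
    ring
  rw [h, e_add]
  ring_nf

end Comb

/-! ### The datum at one scale as a tensor product -/

section Piece

variable {d m : ℕ} {P : Profile d m} {R D₁ D₂ : ℝ}

lemma h₁Hat_eq_comb (hP : P.Admissible) (hR : 0 < R) (hD₁ : 0 < D₁) :
    h₁Hat P R D₁ = comb (P.c * (R / D₁)) (fun l => P.ψ ((R / D₁)⁻¹ • lattice l)) D₁
      ⇑(𝓕 P.φ₁ : 𝓢(Vec d, ℂ)) := by
  funext ξ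
  rw [h₁Hat, comb]
  refine tsum_eq_sum fun l hl => ?_
  rw [mem_latticeBall, not_le] at hl
  have hz : P.ψ ((R / D₁)⁻¹ • lattice l) = 0 := by
    by_contra hne
    have h1 : (R / D₁)⁻¹ • lattice l ∈ closedBall (0 : Vec d) P.c :=
      hP.2.2.2.2.2.2 (by simpa using hne)
    rw [mem_closedBall_zero_iff, norm_smul, norm_inv, Real.norm_of_nonneg (by positivity),
      inv_mul_le_iff₀ (by positivity)] at h1
    linarith
  rw [hz, Complex.ofReal_zero, zero_mul]

lemma h₂Hat_eq_comb :
    h₂Hat P R D₂ = comb (P.c * √R / D₂) (fun _ => 1) D₂ ⇑(𝓕 P.φ₂ : 𝓢(Vec m, ℂ)) := by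
  funext ξ
  rw [h₂Hat, comb, ← Finset.tsum_subtype]
  have hset : {l : Fin m → ℤ | ‖lattice l‖ ≤ P.c * √R / D₂} =
      {l | l ∈ latticeBall m (P.c * √R / D₂)} := by
    ext l
    simp
  simp only [Complex.ofReal_one, one_mul]
  exact (Equiv.setCongr hset).tsum_eq
    fun l : {l // l ∈ latticeBall m (P.c * √R / D₂)} => (𝓕 P.φ₂) (ξ - D₂ • lattice l.1)

/-- The substitution `ξ = R + √R η` normalizes the oscillatory integral in the first variable. -/
lemma integral_gHat_mul_e (hR : 0 < R) (t x : ℝ) :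
    ∫ ξ, gHat P R ξ * e (x * ξ + t * ξ ^ 2) = √R * (e (x * R + t * R ^ 2) *
      ∫ η, (𝓕 P.φ) η * e (√R * (x + 2 * t * R) * η + t * R * η ^ 2)) := by
  have hs : 0 < √R := Real.sqrt_pos.2 hR
  have hsq : √R ^ 2 = R := Real.sq_sqrt hR.le
  rw [← integral_add_right_eq_self _ R]
  have h1 := Measure.integral_comp_mul_left
    (fun ξ => gHat P R (ξ + R) * e (x * (ξ + R) + t * (ξ + R) ^ 2)) √R
  rw [abs_of_pos (by positivity), Complex.real_smul] at h1
  have h2 : (√R : ℂ) * ((√R)⁻¹ : ℝ) = 1 := by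
    rw [← Complex.ofReal_mul, mul_inv_cancel₀ hs.ne', Complex.ofReal_one]
  rw [← one_mul (∫ ξ, gHat P R (ξ + R) * e (x * (ξ + R) + t * (ξ + R) ^ 2)), ← h2, mul_assoc, ← h1,
    ← integral_const_mul (e _)]
  congr 1
  refine integral_congr_ae (ae_of_all _ fun η => ?_)
  simp only [gHat]
  have h3 : (√R * η + R - R) / √R = η := by
    rw [add_sub_cancel_right, mul_div_cancel_left₀ _ hs.ne']
  have h4 : x * (√R * η + R) + t * (√R * η + R) ^ 2 =
      (x * R + t * R ^ 2) + (√R * (x + 2 * t * R) * η + t * R * η ^ 2) := by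
    linear_combination t * η ^ 2 * hsq
  rw [h3, h4, e_add]
  ring

lemma integral_norm_sq_gHat (hR : 0 < R) :
    ∫ ξ, ‖gHat P R ξ‖ ^ 2 = √R * ∫ η, ‖(𝓕 P.φ) η‖ ^ 2 := by
  have hs : 0 < √R := Real.sqrt_pos.2 hR
  have h1 := Measure.integral_comp_div (fun ξ => ‖(𝓕 P.φ) ξ‖ ^ 2) √R
  rw [abs_of_pos hs, smul_eq_mul] at h1
  rw [← h1]
  exact integral_sub_right_eq_self (μ := volume) (fun ξ => ‖(𝓕 P.φ) (ξ / √R)‖ ^ 2) R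

/-- The evolution of the datum factors over the three blocks of variables. -/
lemma pieceEvol_eq_mul (t : ℝ) (x : Vec (d + m + 1)) :
    pieceEvol P R D₁ D₂ t x =
      (∫ ξ, gHat P R ξ * e (x 0 * ξ + t * ξ ^ 2)) *
      (∫ ξ, h₁Hat P R D₁ ξ * e (inner ℝ (mid x) ξ + t * ‖ξ‖ ^ 2)) *
      ∫ ξ, h₂Hat P R D₂ ξ * e (inner ℝ (last x) ξ + t * ‖ξ‖ ^ 2) := by
  rw [← integral_split_mul, pieceEvol]
  refine integral_congr_ae (ae_of_all _ fun ξ => ?_)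
  simp only [pieceHat]
  have h : inner ℝ x ξ + t * ‖ξ‖ ^ 2 = (x 0 * ξ 0 + t * ξ 0 ^ 2) +
      (inner ℝ (mid x) (mid ξ) + t * ‖mid ξ‖ ^ 2) +
      (inner ℝ (last x) (last ξ) + t * ‖last ξ‖ ^ 2) := by
    rw [inner_split, norm_sq_split]
    ring
  rw [h, e_add, e_add]
  ring

/-- The Fourier support of the datum at scale `R` lies at frequencies `O(R)`. -/
lemma norm_le_of_pieceHat_ne_zero (hP : P.Admissible) (hc : P.c ≤ 1) (hR : 1 ≤ R) (hD₁ : 0 < D₁)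
    (hD₂ : 0 < D₂) {ξ : Vec (d + m + 1)} (hξ : pieceHat P R D₁ D₂ ξ ≠ 0) : ‖ξ‖ ≤ 7 * R := by
  have hc0 := hP.1
  have hs : 0 < √R := Real.sqrt_pos.2 (by linarith)
  have hsR : √R ≤ R := Real.sqrt_le_iff.2 ⟨by linarith, by nlinarith⟩
  rw [pieceHat] at hξ
  have h2 := right_ne_zero_of_mul hξ
  have h1 := right_ne_zero_of_mul (left_ne_zero_of_mul hξ)
  have h0 := left_ne_zero_of_mul (left_ne_zero_of_mul hξ)
  rw [h₁Hat_eq_comb hP (by linarith) hD₁] at h1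
  rw [h₂Hat_eq_comb] at h2
  have b1 := norm_le_of_comb_ne_zero hP.2.2.1.2.2 hD₁.le h1
  have b2 := norm_le_of_comb_ne_zero hP.2.2.2.1.2.2 hD₂.le h2
  have b0 : |ξ 0 - R| ≤ P.c * √R := by
    have : (ξ 0 - R) / √R ∈ closedBall (0 : ℝ) P.c := hP.2.1.2.2 h0
    rwa [mem_closedBall_zero_iff, Real.norm_eq_abs, abs_div, abs_of_pos hs, div_le_iff₀ hs] at this
  have e1 : D₁ * (P.c * (R / D₁)) = P.c * R := by field_simp
  have e2 : D₂ * (P.c * √R / D₂) = P.c * √R := by field_simp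
  rw [e1] at b1
  rw [e2] at b2
  have m1 : P.c * R ≤ R := by nlinarith
  have m2 : P.c * √R ≤ R := by nlinarith
  have b0' : |ξ 0| ≤ 2 * R := by
    have := abs_sub_abs_le_abs_sub (ξ 0) R
    rw [abs_of_pos (by linarith : 0 < R)] at this
    linarith
  refine le_of_sq_le_sq ?_ (by linarith)
  rw [norm_sq_split, ← sq_abs (ξ 0)]
  have := norm_nonneg (mid ξ)
  have := norm_nonneg (last ξ)
  have := abs_nonneg (ξ 0)
  nlinarith

lemma contDiff_pieceHat (hP : P.Admissible) (hR : 0 < R) (hD₁ : 0 < D₁) :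
    ContDiff ℝ (⊤ : ℕ∞) (pieceHat P R D₁ D₂) := by
  unfold pieceHat
  rw [h₁Hat_eq_comb hP hR hD₁, h₂Hat_eq_comb]
  refine ContDiff.mul (ContDiff.mul ?_ ((contDiff_comb _).comp contDiff_mid))
    ((contDiff_comb _).comp contDiff_last)
  refine ((𝓕 P.φ).smooth ⊤).comp ?_
  fun_prop

end Piece

/-! ### The size of the datum at one scale -/

lemma hasCompactSupport_of_isBump {V : Type*} [NormedAddCommGroup V] [ProperSpace V] {χ : V → ℂ}
    {c : ℝ} (h : IsBump χ c) : HasCompactSupport χ :=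
  HasCompactSupport.intro (isCompact_closedBall 0 c) fun _ hx =>
    by_contra fun hne => hx (h.2.2 hne)

section Bump

variable {V : Type*} [NormedAddCommGroup V] [NormedSpace ℝ V] [MeasurableSpace V] [BorelSpace V]
  [FiniteDimensional ℝ V] {μ : Measure V} [μ.IsOpenPosMeasure] [IsFiniteMeasureOnCompacts μ]
  {χ : V → ℂ} {c : ℝ}

lemma integral_re_pos_of_isBump (h : IsBump χ c) (hχ : Continuous χ) :
    0 < ∫ x, (χ x).re ∂μ := by
  obtain ⟨x₀, hx₀⟩ := h.2.1
  refine Continuous.integral_pos_of_hasCompactSupport_nonneg_nonzero (x := x₀) (by fun_prop)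
    ((hasCompactSupport_of_isBump h).comp_left Complex.zero_re) (fun x => (h.1 x).2) ?_
  intro h0
  exact hx₀ (Complex.ext h0 (h.1 x₀).1)

lemma integral_norm_sq_pos_of_isBump (h : IsBump χ c) (hχ : Continuous χ) :
    0 < ∫ x, ‖χ x‖ ^ 2 ∂μ := by
  obtain ⟨x₀, hx₀⟩ := h.2.1
  refine Continuous.integral_pos_of_hasCompactSupport_nonneg_nonzero (x := x₀) (by fun_prop)
    ((hasCompactSupport_of_isBump h).comp_left (g := fun z : ℂ => ‖z‖ ^ 2) (by simp))
    (fun x => by positivity) ?_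
  simpa using hx₀

end Bump

section Size

variable {d m : ℕ} {P : Profile d m}

lemma exists_schwartz_pieceHat (hP : P.Admissible) (hc : P.c ≤ 1) {R D₁ D₂ : ℝ} (hR : 1 ≤ R)
    (hD₁ : 0 < D₁) (hD₂ : 0 < D₂) :
    ∃ F : 𝓢(Vec (d + m + 1), ℂ), ⇑F = pieceHat P R D₁ D₂ ∧ HasCompactSupport F := by
  have h : HasCompactSupport (pieceHat P R D₁ D₂) :=
    HasCompactSupport.intro (isCompact_closedBall 0 (7 * R)) fun ξ hξ => by
      by_contra hne
      exact hξ (by simpa using norm_le_of_pieceHat_ne_zero hP hc hR hD₁ hD₂ hne)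
  exact ⟨h.toSchwartzMap (contDiff_pieceHat hP (by linarith) hD₁), rfl, h⟩

lemma norm_toLp_sq {n : ℕ} (F : 𝓢(Vec n, ℂ)) : ‖F.toLp 2‖ ^ 2 = ∫ ξ, ‖F ξ‖ ^ 2 := by
  rw [SchwartzMap.norm_toLp' (by norm_num) (by norm_num)]
  have h0 : 0 ≤ ∫ ξ, ‖F ξ‖ ^ 2 := integral_nonneg fun _ => by positivity
  simp only [ENNReal.toReal_ofNat, Real.rpow_two]
  rw [← Real.rpow_natCast, ← Real.rpow_mul h0]
  norm_num

lemma pieceNorm_eq_norm_toLp {R D₁ D₂ : ℝ} {F : 𝓢(Vec (d + m + 1), ℂ)}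
    (hF : ⇑F = pieceHat P R D₁ D₂) : pieceNorm P R D₁ D₂ = ‖F.toLp 2‖ := by
  rw [pieceNorm, piece, ← hF, ← SchwartzMap.fourierInv_coe, ← SchwartzMap.norm_toLp,
    ← SchwartzMap.norm_fourier_toL2_eq, FourierTransform.fourier_fourierInv_eq]

/-- Plancherel and the tensor product structure give `‖f_R‖₂²` exactly. -/
lemma pieceNorm_sq (hP : P.Admissible) (hc : P.c < 1 / 2) {R D₁ D₂ : ℝ} (hR : 1 ≤ R)
    (hD₁ : 1 ≤ D₁) (hD₂ : 1 ≤ D₂) :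
    pieceNorm P R D₁ D₂ ^ 2 = (√R * ∫ η, ‖(𝓕 P.φ) η‖ ^ 2) *
      ((∑ l ∈ latticeBall d (P.c * (R / D₁)), P.ψ ((R / D₁)⁻¹ • lattice l) ^ 2) *
        ∫ η, ‖(𝓕 P.φ₁) η‖ ^ 2) *
      ((latticeBall m (P.c * √R / D₂)).card * ∫ η, ‖(𝓕 P.φ₂) η‖ ^ 2) := by
  obtain ⟨F, hF, -⟩ := exists_schwartz_pieceHat hP (by linarith) hR (by linarith : 0 < D₁)
    (by linarith : 0 < D₂)
  rw [pieceNorm_eq_norm_toLp hF, norm_toLp_sq, hF]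
  have h1 := integral_norm_sq_comb (ρ := P.c * (R / D₁))
    (w := fun l => P.ψ ((R / D₁)⁻¹ • lattice l)) (𝓕 P.φ₁) hP.2.2.1.2.2 hc hD₁
  have h2 := integral_norm_sq_comb (ρ := P.c * √R / D₂) (w := fun _ => 1) (𝓕 P.φ₂)
    hP.2.2.2.1.2.2 hc hD₂
  simp only [one_pow, Finset.sum_const, nsmul_eq_mul, mul_one] at h2
  rw [← h1, ← h2, ← integral_norm_sq_gHat (by linarith), ← integral_split_mul,
    ← h₁Hat_eq_comb hP (by linarith) (by linarith), ← h₂Hat_eq_comb]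
  simp only [pieceHat, norm_mul, mul_pow]

lemma exists_norm_profile_le (P : Profile d m) : ∃ M : ℝ, 0 < M ∧ ∀ y, |P.ψ y| ≤ M := by
  obtain ⟨M, hM, h⟩ := P.ψ.decay 0 0
  exact ⟨M, hM, fun y => by simpa using h y⟩

/-- `‖f_R‖₂ ≲ R^{1/4} (R / D₁)^{d/2} (R^{1/2} / D₂)^{m/2}`. -/
lemma exists_pieceNorm_sq_le (hP : P.Admissible) (hc : P.c ≤ 1 / 100) :
    ∃ C : ℝ, 0 < C ∧ ∀ R D₁ D₂ : ℝ, 1 ≤ R → 1 ≤ D₁ → 1 ≤ D₂ → (d = 0 ∨ D₁ ≤ R) → D₂ ≤ √R →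
      pieceNorm P R D₁ D₂ ^ 2 ≤ C * (√R * (R / D₁) ^ d * (√R / D₂) ^ m) := by
  obtain ⟨M, hM, hψ⟩ := exists_norm_profile_le P
  have hc0 := hP.1
  set N₀ := ∫ η, ‖(𝓕 P.φ) η‖ ^ 2
  set N₁ := ∫ η, ‖(𝓕 P.φ₁) η‖ ^ 2
  set N₂ := ∫ η, ‖(𝓕 P.φ₂) η‖ ^ 2
  have hN₀ : 0 < N₀ := integral_norm_sq_pos_of_isBump hP.2.1 (𝓕 P.φ).continuous
  have hN₁ : 0 < N₁ := integral_norm_sq_pos_of_isBump hP.2.2.1 (𝓕 P.φ₁).continuous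
  have hN₂ : 0 < N₂ := integral_norm_sq_pos_of_isBump hP.2.2.2.1 (𝓕 P.φ₂).continuous
  refine ⟨N₀ * (3 ^ d * (M ^ 2 * N₁)) * (3 ^ m * N₂), by positivity,
    fun R D₁ D₂ hR hD₁ hD₂ hd hm => ?_⟩
  rw [pieceNorm_sq hP (by linarith) hR hD₁ hD₂]
  have h1 : (∑ l ∈ latticeBall d (P.c * (R / D₁)), P.ψ ((R / D₁)⁻¹ • lattice l) ^ 2) ≤
      3 ^ d * (R / D₁) ^ d * M ^ 2 := by
    have h3 : (2 * (P.c * (R / D₁)) + 1) ^ d ≤ 3 ^ d * (R / D₁) ^ d := by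
      rcases hd with rfl | hd
      · simp
      · have h4 : 1 ≤ R / D₁ := by rwa [le_div_iff₀ (by linarith), one_mul]
        rw [← mul_pow]
        gcongr
        nlinarith
    calc _ ≤ ∑ l ∈ latticeBall d (P.c * (R / D₁)), M ^ 2 := by
          refine Finset.sum_le_sum fun l _ => ?_
          rw [← sq_abs]
          exact pow_le_pow_left₀ (abs_nonneg _) (hψ _) 2
      _ = (latticeBall d (P.c * (R / D₁))).card * M ^ 2 := by
          rw [Finset.sum_const, nsmul_eq_mul]
      _ ≤ _ := by
          gcongr
          exact (card_latticeBall_le d (by positivity)).trans h3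
  have h2 : ((latticeBall m (P.c * √R / D₂)).card : ℝ) ≤ 3 ^ m * (√R / D₂) ^ m := by
    refine (card_latticeBall_le m (by positivity)).trans ?_
    have h4 : 1 ≤ √R / D₂ := by rwa [le_div_iff₀ (by linarith), one_mul]
    rw [← mul_pow, mul_div_assoc]
    gcongr
    nlinarith
  calc _ ≤ (√R * N₀) * ((3 ^ d * (R / D₁) ^ d * M ^ 2) * N₁) * ((3 ^ m * (√R / D₂) ^ m) * N₂) := by
        gcongr
    _ = _ := by ring

/-- Some lattice point has its rescaling in a region where the nonzero continuous `ψ` is bounded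
below. -/
lemma exists_lattice_profile_ge (hP : P.Admissible) :
    ∃ δ : ℝ, 0 < δ ∧ ∃ r₀ : ℝ, ∀ r : ℝ, 0 < r → (d = 0 ∨ r₀ ≤ r) →
      ∃ l : Fin d → ℤ, δ ≤ P.ψ (r⁻¹ • lattice l) := by
  obtain ⟨z, hz⟩ := hP.2.2.2.2.2.1
  have hz0 : 0 < P.ψ z := by
    have h1 := (hP.2.2.2.2.1 z).2
    have h2 : P.ψ z ≠ 0 := by simpa using hz
    exact lt_of_le_of_ne (by simpa using h1) (Ne.symm h2)
  obtain ⟨s, hs, hball⟩ := Metric.continuousAt_iff.1 (P.ψ.continuous.continuousAt (x := z))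
    (P.ψ z / 2) (half_pos hz0)
  refine ⟨P.ψ z / 2, half_pos hz0, (d + 1) / s, fun r hr hd => ?_⟩
  rcases hd with rfl | hd
  · refine ⟨0, ?_⟩
    rw [Subsingleton.elim (r⁻¹ • lattice 0) z]
    linarith
  · refine ⟨fun i => ⌊r * z i⌋, ?_⟩
    set l : Fin d → ℤ := fun i => ⌊r * z i⌋ with hl
    have h1 : ‖r • z - lattice l‖ ≤ d := by
      refine le_of_sq_le_sq ?_ (Nat.cast_nonneg d)
      rw [EuclideanSpace.norm_sq_eq]
      have h2 : ∀ i, ‖(r • z - lattice l) i‖ ^ 2 ≤ 1 := fun i => by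
        have h3 : (r • z - lattice l) i = Int.fract (r * z i) := rfl
        rw [h3, Real.norm_of_nonneg (Int.fract_nonneg _)]
        exact pow_le_one₀ (Int.fract_nonneg _) (Int.fract_lt_one _).le
      refine (Finset.sum_le_sum fun i _ => h2 i).trans ?_
      rw [Finset.sum_const, Finset.card_univ, Fintype.card_fin, nsmul_eq_mul, mul_one]
      exact_mod_cast Nat.le_self_pow two_ne_zero d
    have h4 : dist (r⁻¹ • lattice l) z < s := by
      have h5 : r⁻¹ • lattice l - z = -(r⁻¹ • (r • z - lattice l)) := by
        rw [smul_sub, inv_smul_smul₀ hr.ne', neg_sub]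
      rw [dist_eq_norm, h5, norm_neg, norm_smul, norm_inv, Real.norm_of_nonneg hr.le,
        inv_mul_lt_iff₀ hr]
      rw [div_le_iff₀ hs] at hd
      linarith
    have h6 := hball h4
    rw [Real.dist_eq, abs_lt] at h6
    linarith

/-- `‖f_R‖₂` is bounded below, once `R / D₁` is large or there is no block `x'`. -/
lemma exists_le_pieceNorm (hP : P.Admissible) (hc : P.c ≤ 1 / 100) :
    ∃ ε : ℝ, 0 < ε ∧ ∃ r₀ : ℝ, ∀ R D₁ D₂ : ℝ, 1 ≤ R → 1 ≤ D₁ → 1 ≤ D₂ →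
      (d = 0 ∨ r₀ ≤ R / D₁) → ε ≤ pieceNorm P R D₁ D₂ := by
  obtain ⟨δ, hδ, r₀, hψ⟩ := exists_lattice_profile_ge hP
  have hc0 := hP.1
  set N₀ := ∫ η, ‖(𝓕 P.φ) η‖ ^ 2
  set N₁ := ∫ η, ‖(𝓕 P.φ₁) η‖ ^ 2
  set N₂ := ∫ η, ‖(𝓕 P.φ₂) η‖ ^ 2
  have hN₀ : 0 < N₀ := integral_norm_sq_pos_of_isBump hP.2.1 (𝓕 P.φ).continuous
  have hN₁ : 0 < N₁ := integral_norm_sq_pos_of_isBump hP.2.2.1 (𝓕 P.φ₁).continuous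
  have hN₂ : 0 < N₂ := integral_norm_sq_pos_of_isBump hP.2.2.2.1 (𝓕 P.φ₂).continuous
  refine ⟨√(N₀ * (δ ^ 2 * N₁) * N₂), Real.sqrt_pos.2 (by positivity), r₀,
    fun R D₁ D₂ hR hD₁ hD₂ hd => ?_⟩
  refine Real.sqrt_le_iff.2 ⟨ENNReal.toReal_nonneg, ?_⟩
  rw [pieceNorm_sq hP (by linarith) hR hD₁ hD₂]
  have hr : 0 < R / D₁ := by positivity
  obtain ⟨l, hl⟩ := hψ (R / D₁) hr hd
  have h1 : δ ^ 2 ≤ ∑ l ∈ latticeBall d (P.c * (R / D₁)), P.ψ ((R / D₁)⁻¹ • lattice l) ^ 2 := by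
    have hmem : l ∈ latticeBall d (P.c * (R / D₁)) := by
      have h2 : (R / D₁)⁻¹ • lattice l ∈ closedBall (0 : Vec d) P.c :=
        hP.2.2.2.2.2.2 (by
          simp only [Function.mem_support, ne_eq, Complex.ofReal_eq_zero]
          linarith)
      rw [mem_closedBall_zero_iff, norm_smul, norm_inv, Real.norm_of_nonneg hr.le,
        inv_mul_le_iff₀ hr] at h2
      rw [mem_latticeBall]
      linarith
    calc δ ^ 2 ≤ P.ψ ((R / D₁)⁻¹ • lattice l) ^ 2 := by gcongr
      _ ≤ _ := Finset.single_le_sum (f := fun l => P.ψ ((R / D₁)⁻¹ • lattice l) ^ 2)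
          (fun _ _ => by positivity) hmem
  have h2 : (1 : ℝ) ≤ (latticeBall m (P.c * √R / D₂)).card := by
    have hmem : (0 : Fin m → ℤ) ∈ latticeBall m (P.c * √R / D₂) := by
      rw [mem_latticeBall, lattice_zero, norm_zero]
      positivity
    exact_mod_cast Finset.card_pos.2 ⟨_, hmem⟩
  have h3 : 1 ≤ √R := Real.one_le_sqrt.2 hR
  calc N₀ * (δ ^ 2 * N₁) * N₂ = (1 * N₀) * (δ ^ 2 * N₁) * (1 * N₂) := by ring
    _ ≤ _ := by gcongr

/-- The evolution of `f_R` is negligible away from the line `x₁ + 2tR = 0`: the first factor is a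
non-stationary oscillatory integral, and the others are bounded trivially. -/
lemma exists_norm_pieceEvol_le (hP : P.Admissible) (hc : P.c ≤ 1 / 100) :
    ∃ C : ℝ, 0 < C ∧ ∃ N : ℕ, ∀ R D₁ D₂ t M : ℝ, ∀ x : Vec (d + m + 1), 1 ≤ R → 1 ≤ D₁ → 1 ≤ D₂ →
      1 + |t| * R ≤ M * |x 0 + 2 * t * R| →
      ‖pieceEvol P R D₁ D₂ t x‖ ≤ C * M ^ N / R := by
  obtain ⟨M₁, hM₁, hψ⟩ := exists_norm_profile_le P
  have hc0 := hP.1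
  -- `N` powers of `R ^ (-1 / 2)` absorb `√R` from `g`, `R ^ (d + m)` from the trivial bounds for
  -- `h₁` and `h₂`, and leave `1 / R`
  set N := 2 * (d + m) + 3 with hN
  obtain ⟨C₀, hC₀, hosc⟩ := exists_norm_integral_quadratic_phase_le N (𝓕 P.φ)
  set I₁ := ∫ η, ‖(𝓕 P.φ₁) η‖
  set I₂ := ∫ η, ‖(𝓕 P.φ₂) η‖
  have hI₁ : 0 ≤ I₁ := integral_nonneg fun _ => norm_nonneg _
  have hI₂ : 0 ≤ I₂ := integral_nonneg fun _ => norm_nonneg _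
  refine ⟨C₀ * (3 ^ d * (M₁ * I₁)) * (3 ^ m * I₂) + 1, by positivity, N,
    fun R D₁ D₂ t M x hR hD₁ hD₂ hM => ?_⟩
  have hR0 : 0 < R := by linarith
  have hs : 0 < √R := Real.sqrt_pos.2 hR0
  have hsq : √R ^ 2 = R := Real.sq_sqrt hR0.le
  have hs1 : 1 ≤ √R := Real.one_le_sqrt.2 hR
  have hpos : 0 < 1 + |t| * R := by positivity
  have hx : x 0 + 2 * t * R ≠ 0 := by
    intro h0
    rw [h0, abs_zero, mul_zero] at hM
    linarith
  have hx' : 0 < |x 0 + 2 * t * R| := abs_pos.2 hx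
  have hM0 : 0 < M := by
    by_contra h
    push Not at h
    nlinarith
  have hg : ‖∫ ξ, gHat P R ξ * e (x 0 * ξ + t * ξ ^ 2)‖ ≤ √R * (C₀ * (M / √R) ^ N) := by
    rw [integral_gHat_mul_e hR0, norm_mul, norm_mul, norm_e, one_mul, Complex.norm_real,
      Real.norm_of_nonneg hs.le]
    refine mul_le_mul_of_nonneg_left ?_ hs.le
    refine (hosc _ (t * R) (mul_ne_zero hs.ne' hx)).trans ?_
    rw [abs_mul, abs_mul, abs_of_pos hs, abs_of_pos hR0]
    have h1 : (1 + |t| * R) / (√R * |x 0 + 2 * t * R|) ≤ M / √R := by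
      rw [div_le_div_iff₀ (by positivity) hs]
      nlinarith
    gcongr
  have hb : ∀ {k : ℕ} (f : Vec k → ℂ) (y : Vec k),
      ‖∫ ξ, f ξ * e (inner ℝ y ξ + t * ‖ξ‖ ^ 2)‖ ≤ ∫ ξ, ‖f ξ‖ := fun f y => by
    refine (norm_integral_le_integral_norm _).trans_eq ?_
    simp [norm_e]
  have h₁ : ‖∫ ξ, h₁Hat P R D₁ ξ * e (inner ℝ (mid x) ξ + t * ‖ξ‖ ^ 2)‖ ≤
      (3 * R) ^ d * (M₁ * I₁) := by
    refine (hb _ _).trans ?_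
    rw [h₁Hat_eq_comb hP hR0 (by linarith)]
    refine (integral_norm_comb_le _ (by positivity) fun l => hψ _).trans ?_
    have h2 : R / D₁ ≤ R := div_le_self hR0.le hD₁
    have h3 : 2 * (P.c * (R / D₁)) + 1 ≤ 3 * R := by
      have : 0 < R / D₁ := by positivity
      nlinarith
    gcongr
  have h₂ : ‖∫ ξ, h₂Hat P R D₂ ξ * e (inner ℝ (last x) ξ + t * ‖ξ‖ ^ 2)‖ ≤
      (3 * R) ^ m * (1 * I₂) := by
    refine (hb _ _).trans ?_
    rw [h₂Hat_eq_comb]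
    refine (integral_norm_comb_le (M := 1) _ (by positivity) fun l => by simp).trans ?_
    have h2 : √R / D₂ ≤ √R := div_le_self hs.le hD₂
    have h3 : 2 * (P.c * √R / D₂) + 1 ≤ 3 * R := by
      have : 0 < √R / D₂ := by positivity
      rw [mul_div_assoc]
      nlinarith
    gcongr
  rw [pieceEvol_eq_mul, norm_mul, norm_mul]
  calc _ ≤ (√R * (C₀ * (M / √R) ^ N)) * ((3 * R) ^ d * (M₁ * I₁)) * ((3 * R) ^ m * (1 * I₂)) := by
        gcongr
    _ = (C₀ * (3 ^ d * (M₁ * I₁)) * (3 ^ m * I₂)) * M ^ N / R := by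
        have h4 : √R * R ^ d * R ^ m / √R ^ N = 1 / R := by
          rw [hN, ← hsq, Real.sqrt_sq hs.le, div_eq_div_iff (by positivity) (by positivity)]
          ring
        rw [div_pow, mul_pow, mul_pow]
        linear_combination (C₀ * (3 ^ d * (M₁ * I₁)) * (3 ^ m * I₂)) * M ^ N * h4
    _ ≤ _ := by
        gcongr
        linarith

end Size

/-! ### Series of Schwartz functions in `L²` -/

section Series

variable {n : ℕ}

lemma schrodinger_add (t : ℝ) (f g : Lp ℂ 2 (volume : Measure (Vec n))) :
    schrodinger t (f + g) = schrodinger t f + schrodinger t g := by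
  rw [schrodinger, schrodinger, schrodinger, ← FourierTransform.fourierInv_add]
  congr 1
  apply Lp.ext
  filter_upwards [MemLp.coeFn_toLp (memLp_e_mul t (𝓕 (f + g))),
    Lp.coeFn_add ((memLp_e_mul t (𝓕 f)).toLp _) ((memLp_e_mul t (𝓕 g)).toLp _),
    MemLp.coeFn_toLp (memLp_e_mul t (𝓕 f)), MemLp.coeFn_toLp (memLp_e_mul t (𝓕 g)),
    Lp.coeFn_add (𝓕 f) (𝓕 g)] with ξ h1 h2 h3 h4 h5
  rw [h1, h2, Pi.add_apply, h3, h4, FourierTransform.fourier_add, h5, Pi.add_apply]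
  ring

lemma norm_schrodinger (t : ℝ) (f : Lp ℂ 2 (volume : Measure (Vec n))) :
    ‖schrodinger t f‖ = ‖f‖ := by
  have h1 : ‖schrodinger t f‖ = ‖(memLp_e_mul t (𝓕 f)).toLp _‖ := by
    rw [schrodinger, ← Lp.norm_fourier_eq, FourierTransform.fourier_fourierInv_eq]
  rw [h1, ← Lp.norm_fourier_eq f, Lp.norm_toLp, Lp.norm_def]
  congr 1
  refine eLpNorm_congr_norm_ae (ae_of_all _ fun ξ => ?_)
  rw [norm_mul, norm_e, one_mul]

lemma hasSum_schrodinger {ι : Type*} (t : ℝ) {f : ι → Lp ℂ 2 (volume : Measure (Vec n))}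
    {g : Lp ℂ 2 (volume : Measure (Vec n))} (h : HasSum f g) :
    HasSum (fun j => schrodinger t (f j)) (schrodinger t g) := by
  let S : Lp ℂ 2 (volume : Measure (Vec n)) →+ Lp ℂ 2 (volume : Measure (Vec n)) :=
    AddMonoidHom.mk' (schrodinger t) (schrodinger_add t)
  have hS : Continuous S := AddMonoidHomClass.continuous_of_bound S 1 fun f => by
    rw [one_mul]
    exact (norm_schrodinger t f).le
  exact h.map S hS

lemma schrodinger_smul (t : ℝ) (a : ℂ) (f : Lp ℂ 2 (volume : Measure (Vec n))) :
    schrodinger t (a • f) = a • schrodinger t f := by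
  rw [schrodinger, schrodinger, ← FourierTransform.fourierInv_smul]
  congr 1
  apply Lp.ext
  filter_upwards [MemLp.coeFn_toLp (memLp_e_mul t (𝓕 (a • f))),
    Lp.coeFn_smul a ((memLp_e_mul t (𝓕 f)).toLp _),
    MemLp.coeFn_toLp (memLp_e_mul t (𝓕 f)), Lp.coeFn_smul a (𝓕 f)] with ξ h1 h2 h3 h4
  rw [h1, h2, Pi.smul_apply, h3, FourierTransform.fourier_smul, h4, Pi.smul_apply, smul_eq_mul,
    smul_eq_mul]
  ring

/-- On the Fourier side the Schrödinger group preserves smooth compactly supported functions. -/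
lemma exists_schwartz_evol {F : 𝓢(Vec n, ℂ)} (hF : HasCompactSupport F) (t : ℝ) :
    ∃ G : 𝓢(Vec n, ℂ), ∀ ξ, G ξ = e (t * ‖ξ‖ ^ 2) * F ξ := by
  have h1 : HasCompactSupport fun ξ => e (t * ‖ξ‖ ^ 2) * F ξ := hF.mul_left
  have h2 : ContDiff ℝ (⊤ : ℕ∞) fun ξ : Vec n => e (t * ‖ξ‖ ^ 2) * F ξ :=
    (contDiff_e.comp (contDiff_const.mul (contDiff_norm_sq ℝ))).mul (F.smooth ⊤)
  exact ⟨h1.toSchwartzMap h2, fun _ => rfl⟩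

lemma schrodinger_toLp {F G : 𝓢(Vec n, ℂ)} {t : ℝ} (hG : ∀ ξ, G ξ = e (t * ‖ξ‖ ^ 2) * F ξ) :
    schrodinger t ((𝓕⁻ F).toLp 2) = (𝓕⁻ G).toLp 2 := by
  rw [← SchwartzMap.toLp_fourierInv_eq G, schrodinger]
  congr 1
  apply Lp.ext
  filter_upwards [MemLp.coeFn_toLp (memLp_e_mul t (𝓕 ((𝓕⁻ F).toLp 2))), F.coeFn_toLp 2,
    G.coeFn_toLp 2] with ξ h1 h2 h3
  rw [h1, h3, hG, SchwartzMap.toLp_fourier_eq, FourierTransform.fourier_fourierInv_eq, h2]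

lemma fourierInv_apply_eq_integral {F G : 𝓢(Vec n, ℂ)} {t : ℝ}
    (hG : ∀ ξ, G ξ = e (t * ‖ξ‖ ^ 2) * F ξ) (x : Vec n) :
    (𝓕⁻ G) x = ∫ ξ, F ξ * e (inner ℝ x ξ + t * ‖ξ‖ ^ 2) := by
  rw [SchwartzMap.fourierInv_coe, fourierInv_eq_integral_e]
  refine integral_congr_ae (ae_of_all _ fun ξ => ?_)
  simp only [hG, e_add, real_inner_comm x ξ]
  ring

variable {ι : Type*} {F : ι → 𝓢(Vec n, ℂ)} {a : ι → ℂ}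

lemma ae_hasSum_coeFn_toLp [Countable ι] (hs : Summable fun j => ‖a j‖ * ‖(F j).toLp 2‖) :
    ∀ᵐ x, HasSum (fun j => a j * (𝓕⁻ (F j)) x)
      ((∑' j, a j • (𝓕⁻ (F j)).toLp 2 : Lp ℂ 2 (volume : Measure (Vec n))) x) := by
  have hnorm : ∀ j, ‖a j • (𝓕⁻ (F j)).toLp 2‖ = ‖a j‖ * ‖(F j).toLp 2‖ := fun j => by
    rw [norm_smul, ← SchwartzMap.norm_fourier_toL2_eq (𝓕⁻ (F j)),
      FourierTransform.fourier_fourierInv_eq]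
  have h1 : ∑' j, ‖a j • (𝓕⁻ (F j)).toLp 2‖ₑ ≠ ∞ := by
    rw [tsum_enorm_ne_top_iff_summable_norm]
    simpa only [hnorm] using hs
  have h2 : ∀ᵐ x, ∀ j, (a j • (𝓕⁻ (F j)).toLp 2 : Lp ℂ 2 (volume : Measure (Vec n))) x =
      a j * (𝓕⁻ (F j)) x := by
    rw [ae_all_iff]
    intro j
    filter_upwards [Lp.coeFn_smul (a j) ((𝓕⁻ (F j)).toLp 2), (𝓕⁻ (F j)).coeFn_toLp 2]
      with x h3 h4
    rw [h3, Pi.smul_apply, h4, smul_eq_mul]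
  filter_upwards [Lp.hasSum_coeFn_tsum h1, h2] with x h3 h4
  simpa only [h4] using h3

lemma hasSum_toLp (hs : Summable fun j => ‖a j‖ * ‖(F j).toLp 2‖) :
    HasSum (fun j => a j • (𝓕⁻ (F j)).toLp 2 volume)
      (∑' j, a j • (𝓕⁻ (F j)).toLp 2 : Lp ℂ 2 (volume : Measure (Vec n))) := by
  refine (Summable.of_norm ?_).hasSum
  refine hs.congr fun j => ?_
  rw [norm_smul, ← SchwartzMap.norm_fourier_toL2_eq (𝓕⁻ (F j)),
    FourierTransform.fourier_fourierInv_eq]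

/-- A series of functions with Fourier supports in balls of radius `r_j` belongs to `H^s` if its
`L²` norms, weighted by `(1 + r_j²)^{s/2}`, are summable. -/
lemma memSobolev_tsum {s : ℝ} (hs0 : 0 ≤ s) {r : ι → ℝ}
    (hr : ∀ j ξ, F j ξ ≠ 0 → ‖ξ‖ ≤ r j)
    (hs : Summable fun j => ‖a j‖ * ‖(F j).toLp 2‖)
    (hs' : Summable fun j => ‖a j‖ * ((1 + r j ^ 2) ^ (s / 2) * ‖(F j).toLp 2‖)) :
    TemperedDistribution.MemSobolev s 2
      ((∑' j, a j • (𝓕⁻ (F j)).toLp 2 : Lp ℂ 2 (volume : Measure (Vec n))) : 𝓢'(Vec n, ℂ)) := by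
  set g : Vec n → ℂ := fun x => ((1 + ‖x‖ ^ 2) ^ (s / 2) : ℝ) with hg
  have hgt : g.HasTemperateGrowth := by fun_prop
  set B : ι → 𝓢(Vec n, ℂ) := fun j => SchwartzMap.smulLeftCLM ℂ g (F j) with hB
  have hBapp : ∀ j ξ, B j ξ = g ξ * F j ξ := fun j ξ => by
    rw [hB]
    simp only [SchwartzMap.smulLeftCLM_apply_apply hgt, smul_eq_mul]
  have hBnorm : ∀ j, ‖(B j).toLp 2‖ ≤ (1 + r j ^ 2) ^ (s / 2) * ‖(F j).toLp 2‖ := fun j => by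
    refine Lp.norm_le_mul_norm_of_ae_le_mul ?_
    filter_upwards [(B j).coeFn_toLp 2, (F j).coeFn_toLp 2] with ξ h1 h2
    rw [h1, h2, hBapp, norm_mul]
    by_cases h0 : F j ξ = 0
    · simp [h0]
    · refine mul_le_mul_of_nonneg_right ?_ (norm_nonneg _)
      rw [hg, Complex.norm_real, Real.norm_of_nonneg (by positivity)]
      have := hr j ξ h0
      gcongr
  have hsB : Summable fun j => ‖a j‖ * ‖(B j).toLp 2‖ :=
    hs'.of_nonneg_of_le (fun j => by positivity) fun j =>
      mul_le_mul_of_nonneg_left (hBnorm j) (norm_nonneg _)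
  have hbes : ∀ j, TemperedDistribution.besselPotential (Vec n) ℂ s
      (((𝓕⁻ (F j)).toLp 2 : Lp ℂ 2 (volume : Measure (Vec n))) : 𝓢'(Vec n, ℂ)) =
      (((𝓕⁻ (B j)).toLp 2 : Lp ℂ 2 (volume : Measure (Vec n))) : 𝓢'(Vec n, ℂ)) := fun j => by
    have h1 : 𝓕⁻ (B j) = SchwartzMap.fourierMultiplierCLM ℂ g (𝓕⁻ (F j)) := by
      rw [SchwartzMap.fourierMultiplierCLM_apply, FourierTransform.fourier_fourierInv_eq]
    rw [h1, TemperedDistribution.besselPotential, Lp.toTemperedDistribution_toLp_eq,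
      Lp.toTemperedDistribution_toLp_eq,
      TemperedDistribution.fourierMultiplierCLM_toTemperedDistributionCLM_eq (by fun_prop)]
  refine ⟨∑' j, a j • (𝓕⁻ (B j)).toLp 2, ?_⟩
  have h1 := (hasSum_toLp hs).mapL (Lp.toTemperedDistributionCLM ℂ (volume : Measure (Vec n)) 2)
  have h2 := h1.mapL (TemperedDistribution.besselPotential (Vec n) ℂ s)
  have h3 := (hasSum_toLp hsB).mapL (Lp.toTemperedDistributionCLM ℂ (volume : Measure (Vec n)) 2)
  simp only [map_smul, Lp.toTemperedDistributionCLM_apply, hbes] at h2 h3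
  exact h2.unique h3

end Series

/-! ### The dyadic scales -/

section Scales

variable {d m : ℕ} {P : Profile d m} {X : Exponents}

lemma scale_pos (j : ℕ) : 0 < scale j := by unfold scale; positivity

lemma one_le_scale (j : ℕ) : 1 ≤ scale j := one_le_pow₀ one_le_two

lemma tendsto_scale : Tendsto scale atTop atTop := tendsto_pow_atTop_atTop_of_one_lt one_lt_two

lemma one_le_scale_rpow (j : ℕ) {σ : ℝ} (hσ : 0 ≤ σ) : 1 ≤ scale j ^ σ :=
  Real.one_le_rpow (one_le_scale j) hσ

lemma scale_rpow_le_sqrt (hX : X.Admissible d) (j : ℕ) : scale j ^ X.γ ≤ √(scale j) := by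
  rw [Real.sqrt_eq_rpow]
  exact Real.rpow_le_rpow_of_exponent_le (one_le_scale j) hX.2.2.2.1

lemma eventually_le_scale_div (hX : X.Admissible d) (r : ℝ) :
    ∀ᶠ j in atTop, d = 0 ∨ r ≤ scale j / scale j ^ X.b := by
  rcases hX.2.2.2.2 with hd | hab
  · exact Eventually.of_forall fun _ => Or.inl hd
  · have h1 : Tendsto (fun j => scale j ^ (1 - X.b)) atTop atTop :=
      (tendsto_rpow_atTop (by linarith [hX.1])).comp tendsto_scale
    filter_upwards [h1.eventually_ge_atTop r] with j hj
    right
    rwa [Real.rpow_sub (scale_pos j), Real.rpow_one] at hj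

lemma reg_pos (hX : X.Admissible d) : 0 < X.reg d m := by
  have h1 : 0 ≤ (1 - X.a - X.b) * ((d : ℝ) / 2) := by
    rcases hX.2.2.2.2 with rfl | hab
    · simp
    · exact mul_nonneg (by linarith) (by positivity)
  have h2 : 0 ≤ (1 / 2 - X.γ) * ((m : ℝ) / 2) :=
    mul_nonneg (by linarith [hX.2.2.2.1]) (by positivity)
  unfold Exponents.reg
  linarith

lemma summable_mul_scale_rpow {σ : ℝ} (hσ : σ < 0) :
    Summable fun j : ℕ => (j : ℝ) * scale j ^ σ := by
  have h1 : ‖(2 : ℝ) ^ σ‖ < 1 := by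
    rw [Real.norm_of_nonneg (by positivity)]
    exact Real.rpow_lt_one_of_one_lt_of_neg one_lt_two hσ
  refine (summable_pow_mul_geometric_of_norm_lt_one 1 h1).congr fun j => ?_
  rw [pow_one, scale, ← Real.rpow_natCast, ← Real.rpow_natCast, ← Real.rpow_mul zero_le_two,
    ← Real.rpow_mul zero_le_two, mul_comm σ]

lemma summable_div_scale : Summable fun j : ℕ => (j : ℝ) / scale j := by
  refine (summable_mul_scale_rpow (by norm_num : (-1 : ℝ) < 0)).congr fun j => ?_
  rw [Real.rpow_neg_one, div_eq_mul_inv]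

lemma pieceNorm_nonneg (R D₁ D₂ : ℝ) : 0 ≤ pieceNorm P R D₁ D₂ := ENNReal.toReal_nonneg

lemma coeff_nonneg (j : ℕ) : 0 ≤ coeff P X j := by
  have := (scale_pos j).le
  have := pieceNorm_nonneg (P := P) (scale j) (scale j ^ X.b) (scale j ^ X.γ)
  unfold coeff
  positivity

lemma coeff_mul_pieceNorm_le (j : ℕ) :
    coeff P X j * pieceNorm P (scale j) (scale j ^ X.b) (scale j ^ X.γ) ≤
      j * scale j ^ (-X.reg d m) := by
  have h0 := scale_pos j
  rw [coeff, Real.rpow_neg h0.le]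
  -- at the small scales `f_{R_j}` may vanish, and then the coefficient is `0` as well
  rcases (pieceNorm_nonneg (P := P) (scale j) (scale j ^ X.b) (scale j ^ X.γ)).eq_or_lt with h | h
  · rw [← h, mul_zero]
    positivity
  · refine le_of_eq ?_
    field_simp

/-- The evolution of the `j`-th term is `O(j / R_j)` away from `x₁ + 2tR_j = 0`. -/
lemma exists_norm_termEvol_le (hP : P.Admissible) (hc : P.c ≤ 1 / 100) (hX : X.Admissible d) :
    ∃ C : ℝ, 0 < C ∧ ∃ N J : ℕ, ∀ j, J ≤ j → ∀ (t M : ℝ) (x : Vec (d + m + 1)),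
      1 + |t| * scale j ≤ M * |x 0 + 2 * t * scale j| →
      ‖termEvol P X j t x‖ ≤ C * M ^ N * (j / scale j) := by
  obtain ⟨ε, hε, r₀, hlow⟩ := exists_le_pieceNorm hP hc
  obtain ⟨C, hC, N, hdec⟩ := exists_norm_pieceEvol_le hP hc
  obtain ⟨J, hJ⟩ := eventually_atTop.1 (eventually_le_scale_div hX r₀)
  refine ⟨C / ε, by positivity, N, J, fun j hj t M x hM => ?_⟩
  have h0 := scale_pos j
  have hb := one_le_scale_rpow j hX.2.1
  have hγ := one_le_scale_rpow j hX.2.2.1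
  have h1 := hlow _ _ _ (one_le_scale j) hb hγ (hJ j hj)
  have h2 := hdec _ _ _ t M x (one_le_scale j) hb hγ hM
  have h3 : coeff P X j ≤ j / ε := by
    rw [coeff]
    have h4 := one_le_scale_rpow j (reg_pos (m := m) hX).le
    gcongr
    nlinarith
  rw [termEvol, norm_mul, Complex.norm_real, Real.norm_of_nonneg (coeff_nonneg j)]
  calc _ ≤ (j / ε) * (C * M ^ N / scale j) := by gcongr
    _ = _ := by ring

variable (P X) in
/-- The values `∑_{j ≥ K₀} j e^{itΔ}f_{R_j}(x) / (R_j^{s_m} ‖f_{R_j}‖₂)` of the evolution of the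
datum. -/
def evolution (K₀ : ℕ) (t : ℝ) (x : Vec (d + m + 1)) : ℂ :=
  ∑' j : Set.Ici K₀, termEvol P X j t x

lemma continuous_termEvol (hP : P.Admissible) (hc : P.c ≤ 1 / 100) (hX : X.Admissible d)
    (j : ℕ) (t : ℝ) : Continuous (termEvol P X j t) := by
  have hb := one_le_scale_rpow j hX.2.1
  have hγ := one_le_scale_rpow j hX.2.2.1
  obtain ⟨F, hF, hFc⟩ := exists_schwartz_pieceHat hP (by linarith) (one_le_scale j)
    (by linarith : 0 < scale j ^ X.b) (by linarith : 0 < scale j ^ X.γ)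
  obtain ⟨G, hG⟩ := exists_schwartz_evol hFc t
  have h : termEvol P X j t = fun x => (coeff P X j : ℂ) * (𝓕⁻ G) x := by
    funext x
    rw [termEvol, pieceEvol, fourierInv_apply_eq_integral hG x, hF]
  rw [h]
  have := (𝓕⁻ G).continuous
  fun_prop

/-- For `t ≠ 0` the evolved series converges normally on bounded sets: once `|t| R_j ≥ |ρ| + 1`,
the condition `1 + |t| R_j ≤ 2 |x₁ + 2tR_j|` for decay holds. -/
lemma exists_summable_norm_termEvol_le (hP : P.Admissible) (hc : P.c ≤ 1 / 100)
    (hX : X.Admissible d) {t : ℝ} (ht : t ≠ 0) (ρ : ℝ) :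
    ∃ v : ℕ → ℝ, Summable v ∧ ∀ j, ∀ x : Vec (d + m + 1), ‖x‖ ≤ ρ →
      ‖termEvol P X j t x‖ ≤ v j := by
  obtain ⟨C, hC, N, J, hdec⟩ := exists_norm_termEvol_le hP hc hX
  have ht0 : 0 < |t| := abs_pos.2 ht
  obtain ⟨J', hJ'⟩ := eventually_atTop.1 (tendsto_scale.eventually_ge_atTop ((|ρ| + 1) / |t|))
  set L : ℕ → ℝ := fun j => coeff P X j *
    ∫ ξ, ‖pieceHat P (scale j) (scale j ^ X.b) (scale j ^ X.γ) ξ‖ with hL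
  refine ⟨fun j => if max J J' ≤ j then C * 2 ^ N * (j / scale j) else L j, ?_, fun j x hx => ?_⟩
  · have h1 := summable_div_scale.mul_left (C * 2 ^ N)
    refine (summable_nat_add_iff (max J J')).1 ?_
    refine ((summable_nat_add_iff (max J J')).2 h1).congr fun j => ?_
    rw [if_pos (Nat.le_add_left _ _)]
  · simp only
    split_ifs with hj
    · refine hdec j ((le_max_left _ _).trans hj) t 2 x ?_
      have h1 := hJ' j ((le_max_right _ _).trans hj)
      rw [div_le_iff₀ ht0] at h1
      have h2 : |x 0| ≤ |ρ| := by
        have h3 : |x 0| ≤ ‖x‖ := by simpa using PiLp.norm_apply_le x 0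
        exact h3.trans (hx.trans (le_abs_self ρ))
      have h4 : |2 * t * scale j| = 2 * (|t| * scale j) := by
        rw [abs_mul, abs_mul, abs_of_pos (scale_pos j), abs_two]
        ring
      have h5 := abs_sub_abs_le_abs_sub (2 * t * scale j) (-(x 0))
      rw [abs_neg, sub_neg_eq_add, h4, add_comm (2 * t * scale j)] at h5
      linarith [abs_nonneg ρ]
    · rw [termEvol, norm_mul, Complex.norm_real, Real.norm_of_nonneg (coeff_nonneg j), hL]
      refine mul_le_mul_of_nonneg_left ?_ (coeff_nonneg j)
      rw [pieceEvol]
      refine (norm_integral_le_integral_norm _).trans_eq ?_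
      simp [norm_e]

lemma hasSum_evolution (hP : P.Admissible) (hc : P.c ≤ 1 / 100) (hX : X.Admissible d) (K₀ : ℕ)
    {t : ℝ} (ht : t ≠ 0) (x : Vec (d + m + 1)) :
    HasSum (fun j : Set.Ici K₀ => termEvol P X j t x) (evolution P X K₀ t x) := by
  obtain ⟨v, hv, hle⟩ := exists_summable_norm_termEvol_le hP hc hX ht ‖x‖
  have h : Summable fun j => termEvol P X j t x := hv.of_norm_bounded fun j => hle j x le_rfl
  exact (h.subtype (Set.Ici K₀)).hasSum

lemma continuous_evolution (hP : P.Admissible) (hc : P.c ≤ 1 / 100) (hX : X.Admissible d)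
    (K₀ : ℕ) {t : ℝ} (ht : t ≠ 0) : Continuous (evolution P X K₀ t) := by
  rw [continuous_iff_continuousAt]
  intro x
  obtain ⟨v, hv, hle⟩ := exists_summable_norm_termEvol_le hP hc hX ht (‖x‖ + 1)
  have h : ContinuousOn (evolution P X K₀ t) (ball x 1) := by
    refine continuousOn_tsum (u := fun j : Set.Ici K₀ => v j)
      (fun j => (continuous_termEvol hP hc hX j t).continuousOn) (hv.subtype _) fun j y hy => ?_
    refine hle j y ?_
    have h1 := norm_le_norm_add_norm_sub' y x
    have h2 := mem_ball_iff_norm.1 hy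
    linarith
  exact h.continuousAt (ball_mem_nhds x one_pos)

/-- The datum as a series in `L²`: pointwise convergence, regularity, and its evolution. -/
theorem datum_properties (hP : P.Admissible) (hc : P.c ≤ 1 / 100) (hX : X.Admissible d)
    (K₀ : ℕ) :
    (∀ᵐ x : Vec (d + m + 1), Summable fun j : Set.Ici K₀ => term P X j x) ∧
    ∃ hf : MemLp (datum P X K₀) 2 volume,
      (∀ s : ℝ, s < X.reg d m → TemperedDistribution.MemSobolev s 2
        ((hf.toLp _ : Lp ℂ 2 (volume : Measure (Vec (d + m + 1)))) : 𝓢'(Vec (d + m + 1), ℂ))) ∧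
      IsPointwiseEvolution (hf.toLp _) (evolution P X K₀) := by
  have hex : ∀ j : Set.Ici K₀, ∃ F : 𝓢(Vec (d + m + 1), ℂ),
      ⇑F = pieceHat P (scale j) (scale j ^ X.b) (scale j ^ X.γ) ∧ HasCompactSupport F := fun j => by
    have hb := one_le_scale_rpow j hX.2.1
    have hγ := one_le_scale_rpow j hX.2.2.1
    exact exists_schwartz_pieceHat hP (by linarith) (one_le_scale j) (by linarith) (by linarith)
  choose F hF hFc using hex
  set a : Set.Ici K₀ → ℂ := fun j => coeff P X j with ha
  have hterm : ∀ (j : Set.Ici K₀) x, term P X j x = a j * (𝓕⁻ (F j)) x := fun j x => by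
    rw [term, piece, SchwartzMap.fourierInv_coe, hF]
  have hnorm : ∀ j : Set.Ici K₀, ‖a j‖ * ‖(F j).toLp 2 volume‖ ≤
      (j : ℕ) * scale j ^ (-X.reg d m) := fun j => by
    rw [← pieceNorm_eq_norm_toLp (hF j), ha, Complex.norm_real,
      Real.norm_of_nonneg (coeff_nonneg _)]
    exact coeff_mul_pieceNorm_le _
  have hreg := reg_pos (m := m) hX
  have hs : Summable fun j => ‖a j‖ * ‖(F j).toLp 2 volume‖ :=
    ((summable_mul_scale_rpow (by linarith : -X.reg d m < 0)).subtype (Set.Ici K₀)).of_nonneg_of_le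
      (fun j => by positivity) hnorm
  have hae := ae_hasSum_coeFn_toLp hs
  have hdatum : datum P X K₀ =ᵐ[volume]
      (∑' j, a j • (𝓕⁻ (F j)).toLp 2 volume : Lp ℂ 2 (volume : Measure (Vec (d + m + 1)))) := by
    filter_upwards [hae] with x hx
    rw [datum, ← hx.tsum_eq]
    exact tsum_congr fun j => hterm j x
  have hf : MemLp (datum P X K₀) 2 volume := (memLp_congr_ae hdatum).2 (Lp.memLp _)
  have hfL : (hf.toLp _ : Lp ℂ 2 (volume : Measure (Vec (d + m + 1)))) =
      ∑' j, a j • (𝓕⁻ (F j)).toLp 2 volume := by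
    apply Lp.ext
    exact (MemLp.coeFn_toLp hf).trans hdatum
  refine ⟨?_, hf, ?_, ?_⟩
  · filter_upwards [hae] with x hx
    simpa only [hterm] using hx.summable
  · intro s hs'
    have key : ∀ σ : ℝ, 0 ≤ σ → σ < X.reg d m → TemperedDistribution.MemSobolev σ 2
        ((hf.toLp _ : Lp ℂ 2 (volume : Measure (Vec (d + m + 1)))) :
          𝓢'(Vec (d + m + 1), ℂ)) := by
      intro σ hσ0 hσ
      rw [hfL]
      refine memSobolev_tsum hσ0 (r := fun j : Set.Ici K₀ => 7 * scale j) (fun j ξ hξ => ?_) hs ?_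
      · have hb := one_le_scale_rpow j hX.2.1
        have hγ := one_le_scale_rpow j hX.2.2.1
        rw [hF] at hξ
        exact norm_le_of_pieceHat_ne_zero hP (by linarith) (one_le_scale j) (by linarith)
          (by linarith) hξ
      · have h1 := (summable_mul_scale_rpow (by linarith : σ - X.reg d m < 0)).mul_left
          ((50 : ℝ) ^ (σ / 2))
        refine (h1.subtype (Set.Ici K₀)).of_nonneg_of_le (fun j => by positivity) fun j => ?_
        have h0 := scale_pos j
        have h2 : (1 + (7 * scale j) ^ 2) ^ (σ / 2) ≤ 50 ^ (σ / 2) * scale j ^ σ := by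
          have h3 : (scale j ^ σ : ℝ) = (scale j ^ 2) ^ (σ / 2) := by
            rw [← Real.rpow_natCast, ← Real.rpow_mul h0.le]
            congr 1
            push_cast
            ring
          rw [h3, ← Real.mul_rpow (by norm_num) (by positivity)]
          refine Real.rpow_le_rpow (by positivity) ?_ (by positivity)
          nlinarith [one_le_scale j]
        calc ‖a j‖ * ((1 + (7 * scale j) ^ 2) ^ (σ / 2) * ‖(F j).toLp 2 volume‖)
            ≤ ‖a j‖ * ((50 ^ (σ / 2) * scale j ^ σ) * ‖(F j).toLp 2 volume‖) := by gcongr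
          _ = (50 ^ (σ / 2) * scale j ^ σ) * (‖a j‖ * ‖(F j).toLp 2 volume‖) := by ring
          _ ≤ (50 ^ (σ / 2) * scale j ^ σ) * ((j : ℕ) * scale j ^ (-X.reg d m)) :=
            mul_le_mul_of_nonneg_left (hnorm j) (by positivity)
          _ = 50 ^ (σ / 2) * ((j : ℕ) * scale j ^ (σ - X.reg d m)) := by
            rw [sub_eq_add_neg, Real.rpow_add h0]
            ring
    -- a negative `s` is covered by the case `σ = 0`
    exact (key (max s 0) (le_max_right _ _) (max_lt hs' hreg)).mono (le_max_left _ _)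
  · intro t ht
    refine ⟨continuous_evolution hP hc hX K₀ ht, ?_⟩
    choose G hG using fun j => exists_schwartz_evol (hFc j) t
    have hevol : ∀ (j : Set.Ici K₀) x, termEvol P X j t x = a j * (𝓕⁻ (G j)) x := fun j x => by
      rw [termEvol, pieceEvol, fourierInv_apply_eq_integral (hG j) x, hF]
    have hGnorm : ∀ j, ‖(G j).toLp 2 volume‖ = ‖(F j).toLp 2 volume‖ := fun j => by
      rw [← sq_eq_sq₀ (norm_nonneg _) (norm_nonneg _), norm_toLp_sq, norm_toLp_sq]
      simp [hG, norm_e]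
    have hs₂ : Summable fun j => ‖a j‖ * ‖(G j).toLp 2 volume‖ := by simpa only [hGnorm] using hs
    have h1 := hasSum_schrodinger t (hasSum_toLp hs)
    simp only [schrodinger_smul, schrodinger_toLp (hG _)] at h1
    have h2 : schrodinger t (hf.toLp _) = ∑' j, a j • (𝓕⁻ (G j)).toLp 2 volume := by
      rw [hfL]
      exact h1.unique (hasSum_toLp hs₂)
    rw [h2]
    filter_upwards [ae_hasSum_coeFn_toLp hs₂] with x hx
    rw [evolution, ← hx.tsum_eq]
    exact tsum_congr fun j => hevol j x

end Scales

/-! ### Lower bounds on a slab -/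

section Lower

variable {d m : ℕ} {P : Profile d m} {X : Exponents}

lemma abs_inner_le_mul {n : ℕ} {x y : Vec n} {a b : ℝ} (hx : ‖x‖ ≤ a) (hy : ‖y‖ ≤ b) :
    |inner ℝ x y| ≤ a * b :=
  (abs_real_inner_le_norm x y).trans
    (mul_le_mul hx hy (norm_nonneg _) ((norm_nonneg _).trans hx))

lemma abs_mul_norm_sq_le {n : ℕ} {y : Vec n} {t b : ℝ} (ht : |t| ≤ 1) (hy : ‖y‖ ≤ b) :
    |t * ‖y‖ ^ 2| ≤ b ^ 2 := by
  have h1 : ‖y‖ ^ 2 ≤ b ^ 2 := pow_le_pow_left₀ (norm_nonneg _) hy 2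
  rw [abs_mul, abs_of_nonneg (sq_nonneg ‖y‖)]
  nlinarith [abs_nonneg t, sq_nonneg ‖y‖]

/-- On a slab the normalized phase of the first factor is nearly constant. -/
lemma le_norm_integral_gHat (hP : P.Admissible) (hc : P.c ≤ 1 / 100) {R t x : ℝ} (hR : 1 ≤ R)
    (ht : |t| * R ≤ 1) (hx : |x + 2 * t * R| ≤ 1 / √R) :
    √R * (1 / 2 * ∫ η, ((𝓕 P.φ) η).re) ≤ ‖∫ ξ, gHat P R ξ * e (x * ξ + t * ξ ^ 2)‖ := by
  have hs : 0 < √R := Real.sqrt_pos.2 (by linarith)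
  have hc0 := hP.1
  rw [le_div_iff₀ hs] at hx
  rw [integral_gHat_mul_e (by linarith), norm_mul, norm_mul, norm_e, one_mul, Complex.norm_real,
    Real.norm_of_nonneg hs.le]
  refine mul_le_mul_of_nonneg_left ?_ hs.le
  refine le_trans ?_ (Complex.re_le_norm _)
  refine half_integral_le_re (𝓕 P.φ).integrable
    (integrable_mul_e (𝓕 P.φ).integrable (by fun_prop)) hP.2.1.1 fun η hη => ?_
  have h1 : |η| ≤ P.c := by simpa using hP.2.1.2.2 hη
  have h2 : |√R * (x + 2 * t * R) * η| ≤ P.c := by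
    rw [abs_mul, abs_mul, abs_of_pos hs]
    nlinarith [abs_nonneg η, mul_nonneg hs.le (abs_nonneg (x + 2 * t * R))]
  have h3 : |t * R * η ^ 2| ≤ P.c := by
    rw [abs_mul, abs_mul, abs_of_pos (by linarith : 0 < R), abs_pow]
    have : |η| ^ 2 ≤ P.c := by nlinarith [abs_nonneg η]
    nlinarith [abs_nonneg t, sq_nonneg |η|]
  linarith [abs_add_le (√R * (x + 2 * t * R) * η) (t * R * η ^ 2)]

/-- Near a point of the lattice `D₂⁻¹ ℤᵐ` all translates in `ĥ₂` are nearly in phase. -/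
lemma le_norm_integral_h₂Hat (hP : P.Admissible) (hc : P.c ≤ 1 / 100) {R D₂ t : ℝ} {x : Vec m}
    {k : Fin m → ℤ} (hR : 1 ≤ R) (hD₂ : 0 < D₂) (ht : |t| * R ≤ 1) (hx1 : ‖x‖ ≤ 1)
    (hx : ‖x - (1 / D₂) • lattice k‖ ≤ 1 / √R) :
    (P.c * √R / D₂ / (m + 1)) ^ m * (1 / 2 * ∫ η, ((𝓕 P.φ₂) η).re) ≤
      ‖∫ ξ, h₂Hat P R D₂ ξ * e (inner ℝ x ξ + t * ‖ξ‖ ^ 2)‖ := by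
  have hs : 1 ≤ √R := Real.one_le_sqrt.2 hR
  have hsq : √R ^ 2 = R := Real.sq_sqrt (by linarith)
  have hc0 := hP.1
  have ht1 : |t| ≤ 1 := by nlinarith [abs_nonneg t]
  have hI := integral_re_pos_of_isBump (μ := volume) hP.2.2.2.1 (𝓕 P.φ₂).continuous
  have hρ : 0 ≤ P.c * √R / D₂ := by positivity
  rw [h₂Hat_eq_comb, integral_comb_mul_e]
  refine (mul_le_mul_of_nonneg_right (le_card_latticeBall m hρ) (by positivity)).trans ?_
  refine le_trans ?_ (Complex.re_le_norm _)
  rw [Complex.re_sum, ← nsmul_eq_mul]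
  refine Finset.card_nsmul_le_sum _ _ _ fun l hl => ?_
  rw [mem_latticeBall, le_div_iff₀ hD₂] at hl
  -- modulo `1` the phase of the `l`-th translate is within `1 / 12` of `0`
  set r := D₂ * inner ℝ (x - (1 / D₂) • lattice k) (lattice l) with hr
  have hphase : D₂ * inner ℝ x (lattice l) = r + ((∑ i, k i * l i : ℤ) : ℝ) := by
    rw [hr, inner_sub_left, real_inner_smul_left, inner_lattice]
    field_simp
    ring
  have hr1 : |r| ≤ P.c := by
    rw [hr, abs_mul, abs_of_pos hD₂]
    have h1 := abs_inner_le_mul hx (le_refl ‖lattice l‖)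
    calc D₂ * |inner ℝ (x - (1 / D₂) • lattice k) (lattice l)|
        ≤ D₂ * (1 / √R * ‖lattice l‖) := by gcongr
      _ = (‖lattice l‖ * D₂) / √R := by ring
      _ ≤ P.c := by rwa [div_le_iff₀ (by linarith)]
  have hr2 : |t * D₂ ^ 2 * ‖lattice l‖ ^ 2| ≤ P.c ^ 2 := by
    have h1 : (‖lattice l‖ * D₂) ^ 2 ≤ (P.c * √R) ^ 2 := by gcongr
    rw [mul_pow P.c, hsq] at h1
    calc |t * D₂ ^ 2 * ‖lattice l‖ ^ 2| = |t| * (‖lattice l‖ * D₂) ^ 2 := by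
          rw [mul_assoc, abs_mul, ← mul_pow, mul_comm D₂,
            abs_of_nonneg (sq_nonneg (‖lattice l‖ * D₂))]
      _ ≤ |t| * (P.c ^ 2 * R) := by gcongr
      _ = P.c ^ 2 * (|t| * R) := by ring
      _ ≤ P.c ^ 2 := mul_le_of_le_one_right (by positivity) ht
  rw [hphase, add_right_comm, e_add_intCast, Complex.ofReal_one, one_mul]
  have hfun : ∀ η, e (r + t * D₂ ^ 2 * ‖lattice l‖ ^ 2) * ((𝓕 P.φ₂ : 𝓢(Vec m, ℂ)) η *
      e (inner ℝ x η + 2 * t * D₂ * inner ℝ (lattice l) η + t * ‖η‖ ^ 2)) =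
      (𝓕 P.φ₂ : 𝓢(Vec m, ℂ)) η * e (r + t * D₂ ^ 2 * ‖lattice l‖ ^ 2 +
        (inner ℝ x η + 2 * t * D₂ * inner ℝ (lattice l) η + t * ‖η‖ ^ 2)) := fun η => by
    rw [e_add (r + _)]
    ring
  rw [← integral_const_mul (e _), integral_congr_ae (ae_of_all _ hfun)]
  refine half_integral_le_re (𝓕 P.φ₂).integrable
    (integrable_mul_e (𝓕 P.φ₂).integrable (by fun_prop)) hP.2.2.2.1.1 fun η hη => ?_
  have hη1 : ‖η‖ ≤ P.c := by simpa using hP.2.2.2.1.2.2 hη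
  have h1 := abs_inner_le_mul hx1 hη1
  have h2 : |2 * t * D₂ * inner ℝ (lattice l) η| ≤ 2 * P.c ^ 2 := by
    have h3 := abs_inner_le_mul (le_refl ‖lattice l‖) hη1
    have h4 : |t| * √R ≤ 1 := by nlinarith [abs_nonneg t]
    calc |2 * t * D₂ * inner ℝ (lattice l) η|
        = 2 * |t| * D₂ * |inner ℝ (lattice l) η| := by
          rw [abs_mul, abs_mul, abs_mul, abs_two, abs_of_pos hD₂]
      _ ≤ 2 * |t| * D₂ * (‖lattice l‖ * P.c) := by gcongr
      _ = 2 * |t| * P.c * (‖lattice l‖ * D₂) := by ring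
      _ ≤ 2 * |t| * P.c * (P.c * √R) := by gcongr
      _ = 2 * P.c ^ 2 * (|t| * √R) := by ring
      _ ≤ 2 * P.c ^ 2 := mul_le_of_le_one_right (by positivity) h4
  have h3 := abs_mul_norm_sq_le ht1 hη1
  rw [abs_le] at *
  constructor <;> nlinarith

/-- At a time `p / (D₁² q)` near a point `v / (D₁ q)` the lattice sum in `ĥ₁` is, up to a small
relative error, the Gauss sum of modulus `√q ^ d` times the density of the lattice points. -/
lemma exists_le_norm_integral_h₁Hat (hP : P.Admissible) (hc : P.c ≤ 1 / 100) :
    ∃ ε : ℝ, 0 < ε ∧ ∃ h₀ : ℝ, 0 < h₀ ∧ ∀ (R D₁ : ℝ) (q : ℕ) (p : ℤ) (v : Fin d → ℤ) (x : Vec d),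
      1 ≤ R → 1 ≤ D₁ → Odd q → Int.gcd p q = 1 → (d = 0 ∨ q * D₁ / R ≤ h₀) →
      |p / (D₁ ^ 2 * q)| * R ≤ 1 → ‖x‖ ≤ 1 → ‖x - (1 / (D₁ * q)) • lattice v‖ ≤ 1 / R →
      ε * (R / (D₁ * √q)) ^ d ≤
        ‖∫ ξ, h₁Hat P R D₁ ξ * e (inner ℝ x ξ + p / (D₁ ^ 2 * q) * ‖ξ‖ ^ 2)‖ := by
  have hc0 := hP.1
  have hψb := hP.2.2.2.2
  have hψc : HasCompactSupport fun y => (P.ψ y : ℂ) := hasCompactSupport_of_isBump hψb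
  set Ψ : 𝓢(Vec d, ℂ) := hψc.toSchwartzMap
    (Complex.ofRealCLM.contDiff.comp (P.ψ.smooth ⊤)) with hΨ
  have hΨa : ∀ y, Ψ y = P.ψ y := fun y => rfl
  have hΨc : HasCompactSupport Ψ := hψc
  have hI₁ := integral_re_pos_of_isBump (μ := volume) hP.2.2.1 (𝓕 P.φ₁).continuous
  have hIψ := integral_re_pos_of_isBump (μ := volume) hψb Ψ.continuous
  set I₁ := ∫ η, ((𝓕 P.φ₁) η).re
  set Iψ := ∫ y, (P.ψ y : ℂ).re with hIψd
  obtain ⟨h₀, hh₀, htail⟩ := exists_tsum_norm_lattice_le (𝓕 Ψ) (ε := Iψ / 4) (by positivity)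
  refine ⟨Iψ / 4 * I₁, by positivity, h₀, hh₀,
    fun R D₁ q p v x hR hD₁ hq hp hh ht hx1 hx => ?_⟩
  have hq1 : (1 : ℝ) ≤ q := by exact_mod_cast hq.pos
  have hq0 : (0 : ℝ) < q := by linarith
  have hsq : √(q : ℝ) ^ 2 = q := Real.sq_sqrt hq0.le
  have hsq0 : 0 < √(q : ℝ) := Real.sqrt_pos.2 hq0
  set t := p / (D₁ ^ 2 * q) with htd
  have ht1 : |t| ≤ 1 := by nlinarith [abs_nonneg t]
  set h := q * D₁ / R with hhd
  have h0 : 0 < h := by positivity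
  have hhq : h / q = (R / D₁)⁻¹ := by
    rw [hhd]
    field_simp
  set u := x - (1 / (D₁ * q)) • lattice v with hu
  set y : Vec d → Vec d := fun η => R • u + (2 * t * R) • η with hy
  have hyn : ∀ η, ‖η‖ ≤ P.c → ‖y η‖ ≤ 2 := fun η hη => by
    have h1 : ‖R • u‖ ≤ 1 := by
      rw [norm_smul, Real.norm_of_nonneg (by linarith)]
      rwa [le_div_iff₀' (by linarith)] at hx
    have h2 : ‖(2 * t * R) • η‖ ≤ 1 := by
      rw [norm_smul, Real.norm_eq_abs, abs_mul, abs_mul, abs_two, abs_of_pos (by linarith : 0 < R)]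
      nlinarith [norm_nonneg η, mul_nonneg (abs_nonneg t) (by linarith : 0 ≤ R)]
    linarith [norm_add_le (R • u) ((2 * t * R) • η)]
  set S : Vec d → ℂ := fun η => ∑ l ∈ latticeBall d (P.c * (R / D₁)),
    (P.ψ ((R / D₁)⁻¹ • lattice l) : ℂ) *
      e (D₁ * inner ℝ x (lattice l) + t * D₁ ^ 2 * ‖lattice l‖ ^ 2 +
        2 * t * D₁ * inner ℝ (lattice l) η) with hS
  set θ : Vec d → ℝ := fun η => inner ℝ x η + t * ‖η‖ ^ 2 with hθ
  have hθc : Continuous θ := by fun_prop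
  have hSc : Continuous S := by fun_prop
  -- the Gaussian factor common to all translates comes out of the sum
  have hint : ∫ ξ, h₁Hat P R D₁ ξ * e (inner ℝ x ξ + t * ‖ξ‖ ^ 2) =
      ∫ η, (𝓕 P.φ₁ : 𝓢(Vec d, ℂ)) η * (e (θ η) * S η) := by
    rw [h₁Hat_eq_comb hP (by linarith) (by linarith), integral_comb_mul_e]
    simp only [hS, Finset.mul_sum]
    rw [integral_finsetSum]
    · refine Finset.sum_congr rfl fun l _ => ?_
      rw [← integral_const_mul, ← integral_const_mul]
      refine integral_congr_ae (ae_of_all _ fun η => ?_)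
      simp only [hθ, e_add]
      ring
    · intro l _
      have h1 := (integrable_mul_e (𝓕 P.φ₁).integrable (μ := volume) (θ := fun η => θ η +
        (D₁ * inner ℝ x (lattice l) + t * D₁ ^ 2 * ‖lattice l‖ ^ 2 +
          2 * t * D₁ * inner ℝ (lattice l) η)) (by fun_prop)).const_mul
            (P.ψ ((R / D₁)⁻¹ • lattice l) : ℂ)
      refine h1.congr (ae_of_all _ fun η => ?_)
      simp only [e_add (θ η)]
      ring
  -- modulo `1` the phases are those of a theta sum with rational coefficients and a linear
  -- perturbation `y η` that stays bounded
  have hStheta : ∀ η, S η = ∑' l : Fin d → ℤ, Ψ ((h / q) • lattice l) *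
      e (h / q * inner ℝ (lattice l) (y η)) * ∏ i, e ((p * (l i : ℝ) ^ 2 + v i * l i) / q) := by
    intro η
    rw [tsum_eq_sum (s := latticeBall d (P.c * (R / D₁)))]
    · refine Finset.sum_congr rfl fun l _ => ?_
      rw [hhq, hΨa, mul_assoc (P.ψ _ : ℂ), ← e_sum, ← e_add]
      congr 2
      have hxu : x = u + (1 / (D₁ * q)) • lattice v := by rw [hu]; abel
      have hsum : (∑ i, (p * (l i : ℝ) ^ 2 + v i * l i) / q) =
          (p * ‖lattice l‖ ^ 2 + inner ℝ (lattice v) (lattice l)) / q := by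
        rw [← Finset.sum_div, Finset.sum_add_distrib, ← Finset.mul_sum, norm_sq_lattice,
          inner_lattice]
        push_cast
        rfl
      rw [hsum, hy, hxu, htd]
      simp only [inner_add_left, inner_add_right, real_inner_smul_left, real_inner_smul_right]
      rw [real_inner_comm u]
      field_simp
      ring
    · intro l hl
      rw [mem_latticeBall, not_le] at hl
      rw [hΨa]
      have : (P.ψ ((h / q) • lattice l) : ℂ) = 0 := by
        by_contra hne
        have h1 : ‖(h / q) • lattice l‖ ≤ P.c := by simpa using hψb.2.2 hne
        rw [hhq, norm_smul, Real.norm_of_nonneg (by positivity),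
          inv_mul_le_iff₀ (by positivity)] at h1
        linarith
      rw [this]
      ring
  set Γ : ℂ := gaussSumVec q p v * ((h ^ d)⁻¹ : ℝ) with hΓ
  have hΓn : ‖Γ‖ = (R / (D₁ * √q)) ^ d := by
    rw [hΓ, norm_mul, norm_gaussSumVec hq hp, Complex.norm_real,
      Real.norm_of_nonneg (by positivity), ← inv_pow, ← mul_pow, hhd]
    congr 1
    rw [inv_div, mul_div_assoc', mul_comm D₁, div_eq_div_iff (by positivity) (by positivity)]
    nth_rewrite 3 [← hsq]
    ring
  have hΓ0 : Γ ≠ 0 := by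
    rw [← norm_pos_iff, hΓn]
    positivity
  have hSfac : ∫ η, (𝓕 P.φ₁ : 𝓢(Vec d, ℂ)) η * (e (θ η) * S η) =
      Γ * ∫ η, (𝓕 P.φ₁ : 𝓢(Vec d, ℂ)) η * (e (θ η) * (Γ⁻¹ * S η)) := by
    rw [← integral_const_mul]
    refine integral_congr_ae (ae_of_all _ fun η => ?_)
    field_simp
  rw [hint, hSfac, norm_mul, hΓn, mul_comm]
  refine mul_le_mul_of_nonneg_left ?_ (by positivity)
  refine le_trans ?_ (Complex.re_le_norm _)
  refine mul_integral_le_re_integral_mul (𝓕 P.φ₁).integrable ?_ hP.2.2.1.1 fun η hη => ?_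
  · have hcont : Continuous fun η => (𝓕 P.φ₁ : 𝓢(Vec d, ℂ)) η * (e (θ η) * (Γ⁻¹ * S η)) := by
      have := (𝓕 P.φ₁).continuous
      fun_prop
    exact hcont.integrable_of_hasCompactSupport
      (hasCompactSupport_of_isBump hP.2.2.1).mul_right
  have hη1 : ‖η‖ ≤ P.c := by simpa using hP.2.2.1.2.2 hη
  obtain ⟨hs, htl⟩ := htail h h0 hh (y η) (hyn η hη1)
  have hmain := norm_tsum_theta_sub_le hΨc hq hp v h0 (y η) hs
  rw [← hStheta, ← mul_assoc, ← hΓ] at hmain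
  -- the main term of the normalized theta sum is `ψ̂(-y)`, up to a quarter of `∫ ψ`
  have herr : ‖Γ⁻¹ * S η - (𝓕 Ψ) (-(y η))‖ ≤ Iψ / 4 := by
    have h1 : Γ⁻¹ * S η - (𝓕 Ψ) (-(y η)) = Γ⁻¹ * (S η - Γ * (𝓕 Ψ) (-(y η))) := by
      field_simp
    have h2 : √(q : ℝ) ^ d * (h ^ d)⁻¹ = ‖Γ‖ := by
      rw [hΓ, norm_mul, norm_gaussSumVec hq hp, Complex.norm_real,
        Real.norm_of_nonneg (by positivity)]
    rw [h1, norm_mul, norm_inv, inv_mul_le_iff₀ (norm_pos_iff.2 hΓ0)]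
    refine hmain.trans ?_
    rw [← mul_assoc, h2]
    exact mul_le_mul_of_nonneg_left htl (norm_nonneg _)
  have hA : 1 / 2 * Iψ ≤ (e (θ η) * (𝓕 Ψ) (-(y η))).re := by
    have h1 : e (θ η) * (𝓕 Ψ) (-(y η)) =
        ∫ z, (P.ψ z : ℂ) * e (inner ℝ z (y η) + θ η) := by
      rw [SchwartzMap.fourier_coe, fourier_eq_integral_e, ← integral_const_mul]
      refine integral_congr_ae (ae_of_all _ fun z => ?_)
      simp only [inner_neg_right, neg_neg, e_add, hΨa]
      ring
    rw [h1]
    refine half_integral_le_re Ψ.integrable (integrable_mul_e Ψ.integrable (by fun_prop))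
      hψb.1 fun z hz => ?_
    have hz1 : ‖z‖ ≤ P.c := by simpa using hψb.2.2 hz
    have h2 := abs_inner_le_mul hz1 (hyn η hη1)
    have h3 := abs_inner_le_mul hx1 hη1
    have h4 := abs_mul_norm_sq_le ht1 hη1
    have h5 : P.c ^ 2 ≤ P.c := by nlinarith
    have h6 := abs_add_le (inner ℝ z (y η)) (θ η)
    have h7 := abs_add_le (inner ℝ x η) (t * ‖η‖ ^ 2)
    linarith
  have hdiff : (e (θ η) * (𝓕 Ψ) (-(y η))).re - (e (θ η) * (Γ⁻¹ * S η)).re ≤ Iψ / 4 := by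
    rw [← Complex.sub_re, ← mul_sub]
    refine (Complex.re_le_norm _).trans ?_
    rwa [norm_mul, norm_e, one_mul, norm_sub_rev]
  linarith

end Lower

section Combination

variable {d m : ℕ} {P : Profile d m} {X : Exponents}

lemma exists_le_norm_pieceEvol (hP : P.Admissible) (hc : P.c ≤ 1 / 100) :
    ∃ ε : ℝ, 0 < ε ∧ ∃ h₀ : ℝ, 0 < h₀ ∧
    ∀ (R D₁ D₂ : ℝ) (q : ℕ) (p : Fin (d + m + 1) → ℤ) (x : Vec (d + m + 1)),
      1 ≤ R → 1 ≤ D₁ → 1 ≤ D₂ → Odd q → Int.gcd (p 0) q = 1 → (d = 0 ∨ q * D₁ / R ≤ h₀) →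
      ‖x‖ ≤ 1 → x ∈ slab R D₁ D₂ p q → |x 0 + 2 * (p 0 / (D₁ ^ 2 * q)) * R| ≤ 1 / √R ∧
      ε * (√R * (R / (D₁ * √q)) ^ d * (√R / D₂) ^ m) ≤
        ‖pieceEvol P R D₁ D₂ (p 0 / (D₁ ^ 2 * q)) x‖ := by
  obtain ⟨ε₁, hε₁, h₀, hh₀, h₁⟩ := exists_le_norm_integral_h₁Hat hP hc
  have hI := integral_re_pos_of_isBump (μ := volume) hP.2.1 (𝓕 P.φ).continuous
  have hI₂ := integral_re_pos_of_isBump (μ := volume) hP.2.2.2.1 (𝓕 P.φ₂).continuous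
  have hc0 := hP.1
  set I := ∫ η, ((𝓕 P.φ) η).re
  set I₂ := ∫ η, ((𝓕 P.φ₂) η).re
  refine ⟨1 / 2 * I * ε₁ * ((P.c / (m + 1)) ^ m * (1 / 2 * I₂)), by positivity, h₀, hh₀,
    fun R D₁ D₂ q p x hR hD₁ hD₂ hq hp hh hx hxs => ?_⟩
  obtain ⟨hx₁, hx₂, hx₃⟩ := hxs
  have hq0 : (0 : ℝ) < q := by exact_mod_cast hq.pos
  have hs : 1 ≤ √R := Real.one_le_sqrt.2 hR
  set t := (p 0 : ℝ) / (D₁ ^ 2 * q) with ht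
  have hcentre : x 0 - (-(2 * R / D₁ ^ 2 * (p 0 / q))) = x 0 + 2 * t * R := by
    rw [ht]
    field_simp
    ring
  rw [hcentre] at hx₁
  have hsplit := norm_sq_split x
  have hx0 : |x 0| ≤ 1 := by
    have h3 : |x 0| ≤ ‖x‖ := by simpa using PiLp.norm_apply_le x 0
    exact h3.trans hx
  have hmid : ‖mid x‖ ≤ 1 := by
    refine le_trans ?_ hx
    rw [← sq_le_sq₀ (norm_nonneg _) (norm_nonneg _)]
    nlinarith [sq_nonneg (x 0), sq_nonneg ‖last x‖]
  have hlast : ‖last x‖ ≤ 1 := by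
    refine le_trans ?_ hx
    rw [← sq_le_sq₀ (norm_nonneg _) (norm_nonneg _)]
    nlinarith [sq_nonneg (x 0), sq_nonneg ‖mid x‖]
  have htR : |t| * R ≤ 1 := by
    have h1 : 1 / √R ≤ 1 := (div_le_one (by linarith)).2 hs
    have h2 : |2 * t * R| = 2 * (|t| * R) := by
      rw [abs_mul, abs_mul, abs_two, abs_of_pos (by linarith : 0 < R)]
      ring
    have h3 : |2 * t * R| ≤ |x 0 + 2 * t * R| + |x 0| := by
      have := abs_sub (x 0 + 2 * t * R) (x 0)
      rwa [add_sub_cancel_left] at this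
    linarith
  refine ⟨hx₁, ?_⟩
  have hg := le_norm_integral_gHat hP hc hR htR hx₁
  have hh₁ := h₁ R D₁ q (p 0) _ (mid x) hR hD₁ hq hp hh htR hmid hx₂
  have hh₂ := le_norm_integral_h₂Hat hP hc hR (by linarith) htR hlast hx₃
  rw [pieceEvol_eq_mul, norm_mul, norm_mul]
  calc _ = √R * (1 / 2 * I) * (ε₁ * (R / (D₁ * √q)) ^ d) *
        ((P.c * √R / D₂ / (m + 1)) ^ m * (1 / 2 * I₂)) := by
        rw [show P.c * √R / D₂ / (m + 1) = P.c / (m + 1) * (√R / D₂) by ring, mul_pow]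
        ring
    _ ≤ _ := by gcongr

/-- `R^{s_m} ‖f_R‖₂` is at most the size of the evolution on the slabs. -/
lemma exists_rpow_reg_mul_pieceNorm_le (hP : P.Admissible) (hc : P.c ≤ 1 / 100)
    (hX : X.Admissible d) :
    ∃ C : ℝ, 0 < C ∧ ∀ k : ℕ,
      scale k ^ X.reg d m * pieceNorm P (scale k) (scale k ^ X.b) (scale k ^ X.γ) ≤
        C * (√(scale k) * (scale k / (scale k ^ X.b * √(scale k ^ X.a))) ^ d *
          (√(scale k) / scale k ^ X.γ) ^ m) := by
  obtain ⟨C, hC, hle⟩ := exists_pieceNorm_sq_le hP hc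
  refine ⟨√C, Real.sqrt_pos.2 hC, fun k => ?_⟩
  have h0 := scale_pos k
  have h1 := one_le_scale k
  have hbd : d = 0 ∨ scale k ^ X.b ≤ scale k := by
    refine hX.2.2.2.2.imp_right fun hab => ?_
    calc scale k ^ X.b ≤ scale k ^ (1 : ℝ) :=
          Real.rpow_le_rpow_of_exponent_le h1 (by linarith [hX.1])
      _ = scale k := Real.rpow_one _
  have hn := hle (scale k) _ _ h1 (one_le_scale_rpow k hX.2.1) (one_le_scale_rpow k hX.2.2.1)
    hbd (scale_rpow_le_sqrt hX k)
  have hreg : (scale k ^ X.reg d m) ^ 2 = √(scale k) *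
      (scale k / (scale k ^ X.b * scale k ^ X.a)) ^ d * (√(scale k) / scale k ^ X.γ) ^ m := by
    have e1 : scale k / (scale k ^ X.b * scale k ^ X.a) = scale k ^ (1 - X.a - X.b) := by
      rw [← Real.rpow_add h0, sub_sub, add_comm X.a, Real.rpow_sub h0, Real.rpow_one]
    rw [e1, Real.sqrt_eq_rpow, ← Real.rpow_sub h0, ← Real.rpow_natCast, ← Real.rpow_natCast,
      ← Real.rpow_natCast, ← Real.rpow_mul h0.le, ← Real.rpow_mul h0.le, ← Real.rpow_mul h0.le,
      ← Real.rpow_add h0, ← Real.rpow_add h0]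
    congr 1
    unfold Exponents.reg
    push_cast
    ring
  have hsqa : √(scale k ^ X.a) ^ 2 = scale k ^ X.a := Real.sq_sqrt (by positivity)
  have hsqC : √C ^ 2 = C := Real.sq_sqrt hC.le
  refine le_of_sq_le_sq ?_ (by positivity)
  rw [mul_pow, hreg]
  refine (mul_le_mul_of_nonneg_left hn (by positivity)).trans_eq ?_
  have e2 : (scale k / (scale k ^ X.b * scale k ^ X.a)) ^ d * (scale k / scale k ^ X.b) ^ d =
      ((scale k / (scale k ^ X.b * √(scale k ^ X.a))) ^ d) ^ 2 := by
    rw [← mul_pow, ← pow_mul, mul_comm d, pow_mul, div_pow, mul_pow _ √(scale k ^ X.a), hsqa]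
    congr 1
    field_simp
  rw [mul_pow, hsqC, mul_pow, mul_pow, ← e2]
  ring

/-- On the `k`-th family of slabs the `k`-th term is large at the time `p₁ / (D₁² q)`. -/
lemma exists_le_norm_termEvol (hP : P.Admissible) (hc : P.c ≤ 1 / 100) (hX : X.Admissible d) :
    ∃ ε : ℝ, 0 < ε ∧ ∃ J : ℕ, ∀ k, J ≤ k → ∀ x ∈ slabUnion d m X k ∩ closedBall 0 1,
      ∃ t : ℝ, |x 0 + 2 * t * scale k| ≤ 1 / √(scale k) ∧ ε * k ≤ ‖termEvol P X k t x‖ := by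
  obtain ⟨ε, hε, h₀, hh₀, hlow⟩ := exists_le_norm_pieceEvol hP hc
  obtain ⟨C, hC, hup⟩ := exists_rpow_reg_mul_pieceNorm_le (m := m) hP hc hX
  obtain ⟨δ, hδ, r₀, hpos⟩ := exists_le_pieceNorm hP hc
  obtain ⟨J, hJ⟩ := eventually_atTop.1 (eventually_le_scale_div hX r₀)
  have hev : ∀ᶠ k in atTop, d = 0 ∨ scale k ^ X.a * scale k ^ X.b / scale k ≤ h₀ := by
    rcases hX.2.2.2.2 with hd | hab
    · exact Eventually.of_forall fun _ => Or.inl hd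
    · have h1 : Tendsto (fun k => scale k ^ (-(1 - X.a - X.b))) atTop (𝓝 0) :=
        (tendsto_rpow_neg_atTop (by linarith)).comp tendsto_scale
      filter_upwards [h1.eventually_le_const hh₀] with k hk
      right
      refine le_of_eq_of_le ?_ hk
      have h0 := scale_pos k
      rw [← Real.rpow_add h0, ← Real.rpow_sub_one h0.ne']
      congr 1
      ring
  obtain ⟨J', hJ'⟩ := eventually_atTop.1 hev
  refine ⟨ε / C, by positivity, max J J', fun k hk x hx => ?_⟩
  have h0 := scale_pos k
  have h1 := one_le_scale k
  have hb := one_le_scale_rpow k hX.2.1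
  have hγ := one_le_scale_rpow k hX.2.2.1
  obtain ⟨⟨q, hq, -, hqQ, p, hp, hxs⟩, hx1⟩ := hx
  have hq0 : (0 : ℝ) < q := by exact_mod_cast hq.pos
  have hh : d = 0 ∨ q * scale k ^ X.b / scale k ≤ h₀ := by
    refine (hJ' k ((le_max_right _ _).trans hk)).imp_right fun h => le_trans ?_ h
    gcongr
  obtain ⟨ht, hle⟩ := hlow _ _ _ q p x h1 hb hγ hq hp hh (by simpa using hx1) hxs
  refine ⟨_, ht, ?_⟩
  rw [termEvol, norm_mul, Complex.norm_real, Real.norm_of_nonneg (coeff_nonneg k), coeff]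
  have hn : 0 < pieceNorm P (scale k) (scale k ^ X.b) (scale k ^ X.γ) :=
    hδ.trans_le (hpos _ _ _ h1 hb hγ (hJ k ((le_max_left _ _).trans hk)))
  have hnorm : 0 < scale k ^ X.reg d m *
      pieceNorm P (scale k) (scale k ^ X.b) (scale k ^ X.γ) := by positivity
  rw [div_mul_eq_mul_div, div_mul_eq_mul_div, div_le_div_iff₀ hC hnorm]
  set W := √(scale k) * (scale k / (scale k ^ X.b * √(scale k ^ X.a))) ^ d *
    (√(scale k) / scale k ^ X.γ) ^ m with hW
  have hWle : W ≤ √(scale k) * (scale k / (scale k ^ X.b * √q)) ^ d *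
      (√(scale k) / scale k ^ X.γ) ^ m := by
    rw [hW]
    gcongr
  calc ε * k * (scale k ^ X.reg d m * pieceNorm P (scale k) (scale k ^ X.b) (scale k ^ X.γ))
      ≤ ε * k * (C * W) := mul_le_mul_of_nonneg_left (hup k) (by positivity)
    _ = k * (ε * W) * C := by ring
    _ ≤ k * ‖pieceEvol P (scale k) (scale k ^ X.b) (scale k ^ X.γ)
          (p 0 / ((scale k ^ X.b) ^ 2 * q)) x‖ * C := by
        gcongr
        exact (mul_le_mul_of_nonneg_left hWle hε.le).trans hle

end Combination

/-! ### Divergence -/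

section Divergence

variable {d m : ℕ} {P : Profile d m} {X : Exponents}

/-- If `x₁ + 2tR_k` is small, then `x₁ + 2tR_j` is comparable to `1 + |t|R_j` at every other
dyadic scale. -/
lemma one_add_mul_scale_le {ε y t : ℝ} {j k : ℕ} (hε : 0 < ε) (hy : ε ≤ |y|)
    (ht : |t| * scale k ≤ 1) (hk : |y + 2 * t * scale k| ≤ ε / 4) (hjk : j ≠ k) :
    1 + |t| * scale j ≤ 8 / ε * |y + 2 * t * scale j| := by
  have h0 := scale_pos k
  set ρ := scale j / scale k with hρ
  have hj : scale j = ρ * scale k := by rw [hρ]; field_simp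
  have hρ0 : 0 < ρ := div_pos (scale_pos j) h0
  have hid : y + 2 * t * scale j = (1 - ρ) * y + ρ * (y + 2 * t * scale k) := by rw [hj]; ring
  have htri : |1 - ρ| * |y| - ρ * |y + 2 * t * scale k| ≤ |y + 2 * t * scale j| := by
    have h1 := abs_sub_abs_le_abs_sub ((1 - ρ) * y) (-(ρ * (y + 2 * t * scale k)))
    rwa [abs_neg, sub_neg_eq_add, ← hid, abs_mul, abs_mul, abs_of_pos hρ0] at h1
  have htj : |t| * scale j ≤ ρ := by
    rw [hj]
    nlinarith
  rw [div_mul_eq_mul_div, le_div_iff₀ hε]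
  have h2 : ρ * |y + 2 * t * scale k| ≤ ρ * (ε / 4) := by gcongr
  rcases lt_or_gt_of_ne hjk with h | h
  · have h3 : ρ ≤ 1 / 2 := by
      rw [hρ, div_le_iff₀ h0, scale, scale]
      have h4 : (2 : ℝ) ^ (j + 1) ≤ 2 ^ k := pow_le_pow_right₀ one_le_two h
      rw [pow_succ] at h4
      linarith
    rw [abs_of_nonneg (by linarith)] at htri
    have h4 : 1 / 2 * ε ≤ (1 - ρ) * |y| := mul_le_mul (by linarith) hy hε.le (by linarith)
    nlinarith
  · have h3 : 2 ≤ ρ := by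
      rw [hρ, le_div_iff₀ h0, scale, scale]
      have h4 : (2 : ℝ) ^ (k + 1) ≤ 2 ^ j := pow_le_pow_right₀ one_le_two h
      rw [pow_succ] at h4
      linarith
    rw [abs_of_nonpos (by linarith)] at htri
    have h4 : (ρ / 2) * ε ≤ -(1 - ρ) * |y| := mul_le_mul (by linarith) hy hε.le (by linarith)
    nlinarith

/-- At a point of the `k`-th family of slabs, some time of size `1 / R_k` makes the `k`-th term
of the evolved series large, and the other terms contribute a bounded amount. -/
lemma exists_le_norm_evolution (hP : P.Admissible) (hc : P.c ≤ 1 / 100) (hX : X.Admissible d) :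
    ∃ c₁ : ℝ, 0 < c₁ ∧ ∃ J₀ : ℕ, ∀ ε : ℝ, 0 < ε → ∃ J : ℕ, ∃ B : ℝ,
      ∀ K₀, J₀ ≤ K₀ → ∀ k, K₀ ≤ k → J ≤ k → ∀ x ∈ slabUnion d m X k ∩ closedBall 0 1,
      ε ≤ |x 0| → ∃ t : ℝ, ε / 4 * (scale k)⁻¹ ≤ |t| ∧ |t| ≤ (scale k)⁻¹ ∧
        c₁ * k - B ≤ ‖evolution P X K₀ t x‖ := by
  obtain ⟨c₁, hc₁, J₁, hlow⟩ := exists_le_norm_termEvol (m := m) hP hc hX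
  obtain ⟨C, hC, N, J₂, hup⟩ := exists_norm_termEvol_le hP hc hX
  refine ⟨c₁, hc₁, max J₁ J₂, fun ε hε => ?_⟩
  have hsqrt : Tendsto (fun k => 1 / √(scale k)) atTop (𝓝 0) := by
    simp only [one_div]
    exact tendsto_inv_atTop_zero.comp (Real.tendsto_sqrt_atTop.comp tendsto_scale)
  obtain ⟨J, hJ⟩ := eventually_atTop.1 (hsqrt.eventually_le_const (by positivity : 0 < ε / 4))
  set g : ℕ → ℝ := fun j => C * (8 / ε) ^ N * (j / scale j) with hg
  have hgs : Summable g := summable_div_scale.mul_left _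
  have hg0 : ∀ j, 0 ≤ g j := fun j => by
    have := (scale_pos j).le
    positivity
  refine ⟨J, ∑' j, g j, fun K₀ hK₀ k hk hJk x hx hxε => ?_⟩
  have h0 := scale_pos k
  obtain ⟨t, ht, hle⟩ := hlow k ((le_max_left _ _).trans (hK₀.trans hk)) x hx
  have hx0 : |x 0| ≤ 1 := by
    have h1 : |x 0| ≤ ‖x‖ := by simpa using PiLp.norm_apply_le x 0
    exact h1.trans (by simpa using hx.2)
  have hsmall := ht.trans (hJ k hJk)
  have hone : 1 / √(scale k) ≤ 1 :=
    (div_le_one (Real.sqrt_pos.2 h0)).2 (Real.one_le_sqrt.2 (one_le_scale k))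
  have h2t : |2 * t * scale k| = 2 * (|t| * scale k) := by
    rw [abs_mul, abs_mul, abs_two, abs_of_pos h0]
    ring
  have htu : |t| * scale k ≤ 1 := by
    have h1 := abs_sub (x 0 + 2 * t * scale k) (x 0)
    rw [add_sub_cancel_left, h2t] at h1
    linarith
  have htl : ε / 4 ≤ |t| * scale k := by
    have h1 := abs_sub (x 0 + 2 * t * scale k) (2 * t * scale k)
    rw [add_sub_cancel_right, h2t] at h1
    linarith
  have ht0 : t ≠ 0 := by
    rintro rfl
    rw [abs_zero, zero_mul] at htl
    linarith
  refine ⟨t, ?_, ?_, ?_⟩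
  · rwa [← div_eq_mul_inv, div_le_iff₀ h0]
  · rwa [← one_div, le_div_iff₀ h0]
  have hsum := hasSum_evolution hP hc hX K₀ ht0 x
  have hsplit := hsum.summable.tsum_eq_add_tsum_ite (⟨k, hk⟩ : Set.Ici K₀)
  rw [hsum.tsum_eq] at hsplit
  have hrest : ‖∑' j : Set.Ici K₀, if j = ⟨k, hk⟩ then 0 else termEvol P X j t x‖ ≤
      ∑' j, g j := by
    refine (tsum_of_norm_bounded (hgs.subtype (Set.Ici K₀)).hasSum fun j => ?_).trans
      (hgs.tsum_subtype_le g _ hg0)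
    split_ifs with hjk
    · rw [norm_zero]
      exact hg0 _
    · refine hup j.1 ((le_max_right _ _).trans (hK₀.trans j.2)) t (8 / ε) x ?_
      exact one_add_mul_scale_le hε hxε htu hsmall fun h => hjk (Subtype.ext h)
  have htri := norm_sub_le_norm_add (termEvol P X k t x)
    (∑' j : Set.Ici K₀, if j = ⟨k, hk⟩ then 0 else termEvol P X j t x)
  rw [← hsplit] at htri
  linarith

/-- The growth `c₁k - B` at times of size `1 / R_k` forces divergence at every point that lies in
infinitely many families of slabs. -/
lemma exists_limsup_evolution_eq_top (hP : P.Admissible) (hc : P.c ≤ 1 / 100)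
    (hX : X.Admissible d) :
    ∃ J₀ : ℕ, ∀ K₀, J₀ ≤ K₀ → ∀ x ∈ limsup (slabUnion d m X) atTop ∩ closedBall 0 1, x 0 ≠ 0 →
      limsup (fun t : ℝ => ‖evolution P X K₀ t x‖ₑ) (𝓝[≠] 0) = ⊤ := by
  obtain ⟨c₁, hc₁, J₀, h⟩ := exists_le_norm_evolution (m := m) hP hc hX
  refine ⟨J₀, fun K₀ hK₀ x hx hx0 => ?_⟩
  obtain ⟨J, B, hlow⟩ := h |x 0| (abs_pos.2 hx0)
  refine ENNReal.eq_top_of_forall_nnreal_le fun M => ?_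
  refine le_limsup_of_frequently_le (frequently_iff.2 fun {U} hU => ?_)
  obtain ⟨δ, hδ, hsub⟩ := Metric.mem_nhdsWithin_iff.1 hU
  have hfreq := mem_limsup_iff_frequently_mem.1 hx.1
  have hsmall : ∀ᶠ k in atTop, (scale k)⁻¹ < δ :=
    (tendsto_inv_atTop_zero.comp tendsto_scale).eventually_lt_const hδ
  have hlarge : ∀ᶠ k : ℕ in atTop, (M + B) / c₁ ≤ k :=
    tendsto_natCast_atTop_atTop.eventually_ge_atTop _
  obtain ⟨k, hkx, hkδ, hkM, hk, hkJ⟩ := (hfreq.and_eventually (hsmall.and (hlarge.and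
    ((eventually_ge_atTop K₀).and (eventually_ge_atTop J))))).exists
  obtain ⟨t, ht₁, ht₂, ht₃⟩ := hlow K₀ hK₀ k hk hkJ x ⟨hkx, hx.2⟩ le_rfl
  have ht0 : t ≠ 0 := by
    have h1 : 0 < |x 0| / 4 * (scale k)⁻¹ :=
      mul_pos (div_pos (abs_pos.2 hx0) four_pos) (inv_pos.2 (scale_pos k))
    exact abs_pos.1 (h1.trans_le ht₁)
  refine ⟨t, hsub ⟨?_, ht0⟩, ?_⟩
  · rw [mem_ball_zero_iff, Real.norm_eq_abs]
    exact ht₂.trans_lt hkδ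
  · rw [div_le_iff₀ hc₁] at hkM
    rw [← ofReal_norm, ← ENNReal.ofReal_coe_nnreal]
    exact ENNReal.ofReal_le_ofReal (by linarith)

end Divergence

end DyadicDivergence

end

theorem mainTheorem6 (d m : ℕ) :
    ∃ c₀ : ℝ, 0 < c₀ ∧
    ∀ P : Dyadic.Profile d m, P.Admissible → P.c ≤ c₀ →
    ∀ X : Dyadic.Exponents, X.Admissible d →
    ∃ C : ℝ, 0 < C ∧ ∃ K : ℕ, ∀ K₀ : ℕ, K ≤ K₀ →
      (∀ᵐ x : Dyadic.Vec (d + m + 1), Summable fun j : Set.Ici K₀ => Dyadic.term P X j x) ∧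
      ∃ hf : MemLp (Dyadic.datum P X K₀) 2 volume,
        (∀ s : ℝ, s < X.reg d m →
          TemperedDistribution.MemSobolev s 2
            ((hf.toLp _ : Lp ℂ 2 (volume : Measure (Dyadic.Vec (d + m + 1)))) :
              𝓢'(Dyadic.Vec (d + m + 1), ℂ))) ∧
        ∃ u : ℝ → Dyadic.Vec (d + m + 1) → ℂ,
          Dyadic.IsPointwiseEvolution (hf.toLp _) u ∧
          (∀ t : ℝ, t ≠ 0 → ∀ x : Dyadic.Vec (d + m + 1),
            HasSum (fun j : Set.Ici K₀ => Dyadic.termEvol P X j t x) (u t x)) ∧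
          (∀ k : ℕ, K₀ ≤ k → ∀ x ∈ Dyadic.slabUnion d m X k ∩ closedBall 0 1,
            1 / 10 < |x 0| → |x 0| ≤ 1 →
            ∃ t : ℝ, C⁻¹ * (Dyadic.scale k)⁻¹ ≤ |t| ∧ |t| ≤ C * (Dyadic.scale k)⁻¹ ∧
              C⁻¹ * k ≤ ‖u t x‖) ∧
          (∀ x ∈ limsup (Dyadic.slabUnion d m X) atTop ∩ closedBall 0 1, x 0 ≠ 0 →
            limsup (fun t : ℝ => ‖u t x‖ₑ) (𝓝[≠] 0) = ⊤) := by
  refine ⟨1 / 100, by norm_num, fun P hP hc X hX => ?_⟩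
  obtain ⟨c₁, hc₁, J₀, hlow⟩ := DyadicDivergence.exists_le_norm_evolution (m := m) hP hc hX
  obtain ⟨J₁, hdiv⟩ := DyadicDivergence.exists_limsup_evolution_eq_top (m := m) hP hc hX
  obtain ⟨J, B, hlow⟩ := hlow (1 / 10) (by norm_num)
  obtain ⟨J₂, hJ₂⟩ := exists_nat_ge (2 * B / c₁)
  refine ⟨max (2 / c₁) 40, by positivity, max (max J₀ J₁) (max J J₂), fun K₀ hK₀ => ?_⟩
  simp only [max_le_iff] at hK₀
  obtain ⟨hae, hf, hs, hu⟩ := DyadicDivergence.datum_properties hP hc hX K₀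
  refine ⟨hae, hf, hs, DyadicDivergence.evolution P X K₀, hu,
    fun t ht x => DyadicDivergence.hasSum_evolution hP hc hX K₀ ht x, fun k hk x hx hx₁ _ => ?_,
    hdiv K₀ hK₀.1.2⟩
  obtain ⟨t, ht₁, ht₂, ht₃⟩ := hlow K₀ hK₀.1.1 k hk (hK₀.2.1.trans hk) x hx hx₁.le
  have hR : 0 < (Dyadic.scale k)⁻¹ := inv_pos.2 (DyadicDivergence.scale_pos k)
  have h40 : (max (2 / c₁) 40)⁻¹ ≤ (1 / 40 : ℝ) := by
    rw [one_div]
    exact inv_anti₀ (by norm_num : (0 : ℝ) < 40) (le_max_right _ _)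
  have hc₂ : (max (2 / c₁) 40)⁻¹ ≤ c₁ / 2 := by
    rw [← inv_div 2 c₁]
    exact inv_anti₀ (div_pos two_pos hc₁) (le_max_left _ _)
  have hk₂ : 2 * B / c₁ ≤ k := hJ₂.trans (by exact_mod_cast hK₀.2.2.trans hk)
  rw [div_le_iff₀ hc₁] at hk₂
  have hk₀ : (0 : ℝ) ≤ k := k.cast_nonneg
  refine ⟨t, ?_, ?_, ?_⟩
  · exact (mul_le_mul_of_nonneg_right (h40.trans (by norm_num)) hR.le).trans ht₁
  · refine ht₂.trans (le_mul_of_one_le_left hR.le ?_)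
    exact le_trans (by norm_num) (le_max_right _ _)
  · exact (mul_le_mul_of_nonneg_right hc₂ hk₀).trans (by linarith)
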